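/- An election $E=(C,V)$ consists of a set $C$ of $m$ candidates and a collection $V=(v_1,\dots,v_n)$ of voters, each of whom ranks all candidates from the most to the least desirable; $\mathrm{pos}_v(c)\in\{1,\dots,m\}$ denotes the position of $c$ in the ranking of $v$. The $\beta$-CC (Chamberlin--Courant) score of a committee $S\subseteq C$ is $\sum_{v\in V}\max_{c\in S}\,(m-\mathrm{pos}_v(c))$, i.e. each voter contributes the Borda score of his or her highest-ranked member of $S$. For a committee size $k$, $\beta\text{-}\mathrm{CC}(E,k)$ is the set of all size-$k$ subsets of $C$ with the highest $\beta$-CC score. In the problem $\beta$-CC \textsc{Robustness Radius} we are given an election $E$, a committee size $k$ and a nonnegative integer $B$, and we ask whether some election $E'$ with $\beta\text{-}\mathrm{CC}(E',k)\neq\beta\text{-}\mathrm{CC}(E,k)$ can be obtained from $E$ by at most $B$ swaps of adjacent candidates within the rankings of the voters. \textbf{Theorem.} $\beta$-CC \textsc{Robustness Radius} is in $\mathrm{FPT}$ when parameterized by the number $n$ of voters: there are a computable function $f\colon\mathbb{N}\to\mathbb{N}$, a constant $c$, and a single algorithm (a program of a random access machine with unit-cost addition and subtraction) that correctly decides every instance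 $I$ in at most $f(n)\cdot|I|^{c}$ steps, where $|I|$ is the length of the encoding of $I$ with all numbers written in binary. -/

import Mathlib

namespace RobustCC

/-! ### Elections and the Chamberlin--Courant rule -/

/-- An election with candidates `Fin m` and voters `Fin n`. The vote `E v` of voter `v` is a ranking:
`E v i` is the candidate at the `i`-th place (counted from `0`), from the most to the least
desirable one. -/
abbrev Election (m n : ℕ) : Type := Fin n → Equiv.Perm (Fin m)

/-- The position of candidate `c` in the vote of `v`; the top-ranked candidate has position `1`. -/
def pos {m n : ℕ} (E : Election m n) (v : Fin n) (c : Fin m) : ℕ := ((E v).symm c : ℕ) + 1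

/-- The Borda scoring function `β_m(i) = m - i`, applied to positions `1 ≤ i ≤ m` only. -/
def borda (m i : ℕ) : ℕ := m - i

/-- The score of committee `S` in the vote of `v`: the Borda score of the highest-ranked member of
`S`, that is, the largest Borda score of a member (the value for the empty committee is `0`). -/
def voteScore {m n : ℕ} (E : Election m n) (v : Fin n) (S : Finset (Fin m)) : ℕ :=
  S.sup fun c => borda m (pos E v c)

/-- The `β`-CC score of a committee. -/
def ccScore {m n : ℕ} (E : Election m n) (S : Finset (Fin m)) : ℕ :=
  ∑ v, voteScore E v S

/-- A multiwinner rule maps an election and a committee size to the set of winning committees. -/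
abbrev MultiwinnerRule : Type := ∀ m n : ℕ, Election m n → ℕ → Set (Finset (Fin m))

/-- The `β`-CC rule: the committees of size `k` with the highest `β`-CC score. -/
def betaCC : MultiwinnerRule := fun m _ E k =>
  {S : Finset (Fin m) | S.card = k ∧ ∀ T : Finset (Fin m), T.card = k → ccScore E T ≤ ccScore E S}

/-! ### The Robustness Radius problem -/

/-- `E'` is obtained from `E` by one swap of two adjacent candidates in one vote. -/
def AdjSwap {m n : ℕ} (E E' : Election m n) : Prop :=
  ∃ (v : Fin n) (i j : Fin m), (j : ℕ) = (i : ℕ) + 1 ∧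
    E' = Function.update E v ((Equiv.swap i j).trans (E v))

/-- `SwapReach B E E'`: the election `E'` is obtained from `E` by at most `B` adjacent swaps. -/
inductive SwapReach {m n : ℕ} : ℕ → Election m n → Election m n → Prop
  | refl (B : ℕ) (E : Election m n) : SwapReach B E E
  | step {B : ℕ} {E E' E'' : Election m n} :
      SwapReach B E E' → AdjSwap E' E'' → SwapReach (B + 1) E E''

/-- An instance of Robustness Radius: an election with `m` candidates and `n` voters, a committee
size `k` and a bound `B` on the number of swaps. -/
structure Instance where
  m : ℕ
  n : ℕ
  election : Election m n
  k : ℕ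
  B : ℕ

/-- The question of the Robustness Radius problem for the rule `R`. -/
def RobustnessRadius (R : MultiwinnerRule) (I : Instance) : Prop :=
  ∃ E' : Election I.m I.n, SwapReach I.B I.election E' ∧ R I.m I.n E' I.k ≠ R I.m I.n I.election I.k

/-- The encoding of an instance as a sequence of natural numbers: the number of voters, the number
of candidates, `k`, `B`, and then the votes one after the other, each as the list of its candidates
from the top to the bottom. -/
def Instance.encode (I : Instance) : List ℕ :=
  [I.n, I.m, I.k, I.B] ++
    (List.finRange I.n).flatMap fun v => List.ofFn fun i : Fin I.m => ((I.election v i : Fin I.m) : ℕ)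

/-! ### Random access machines

Programs of a random access machine on natural numbers, with variables and arrays (a program
mentions finitely many of them), and the operations addition, truncated subtraction, indirect
reading and indirect writing at unit cost. There is no multiplication, so that the number of bits
of a value grows by at most one per step and the running time is polynomially related to the
running time on a Turing machine. -/

/-- Expressions. -/
inductive Expr where
  | const (c : ℕ)
  | var (x : ℕ)
  | add (e₁ e₂ : Expr)
  | sub (e₁ e₂ : Expr)
  | read (a : ℕ) (e : Expr)

/-- Programs. -/
inductive Prog where
  | skip
  | assign (x : ℕ) (e : Expr)
  | write (a : ℕ) (e₁ e₂ : Expr)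
  | seq (p q : Prog)
  | ite (e : Expr) (p q : Prog)
  | loop (e : Expr) (p : Prog)

/-- A memory state: the values of the variables, and the contents of the arrays. -/
structure State where
  var : ℕ → ℕ
  arr : ℕ → ℕ → ℕ

/-- The value of an expression. -/
def Expr.eval (s : State) : Expr → ℕ
  | const c => c
  | var x => s.var x
  | add e₁ e₂ => e₁.eval s + e₂.eval s
  | sub e₁ e₂ => e₁.eval s - e₂.eval s
  | read a e => s.arr a (e.eval s)

/-- The number of steps for evaluating an expression: one for every operation in it. -/
def Expr.cost : Expr → ℕ
  | const _ => 1
  | var _ => 1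
  | add e₁ e₂ => e₁.cost + e₂.cost + 1
  | sub e₁ e₂ => e₁.cost + e₂.cost + 1
  | read _ e => e.cost + 1

/-- `s` with the variable `x` set to `a`. -/
def State.setVar (s : State) (x a : ℕ) : State :=
  { s with var := Function.update s.var x a }

/-- `s` with the cell `i` of the array `a` set to `b`. -/
def State.setArr (s : State) (a i b : ℕ) : State :=
  { s with arr := Function.update s.arr a (Function.update (s.arr a) i b) }

/-- `Runs p s s' t`: started in the state `s`, the program `p` stops in the state `s'` after exactly
`t` steps. Tests succeed on nonzero values. -/
inductive Runs : Prog → State → State → ℕ → Prop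
  | skip (s : State) : Runs .skip s s 1
  | assign (x : ℕ) (e : Expr) (s : State) :
      Runs (.assign x e) s (s.setVar x (e.eval s)) (e.cost + 1)
  | write (a : ℕ) (e₁ e₂ : Expr) (s : State) :
      Runs (.write a e₁ e₂) s (s.setArr a (e₁.eval s) (e₂.eval s)) (e₁.cost + e₂.cost + 1)
  | seq {p q : Prog} {s s' s'' : State} {t t' : ℕ} :
      Runs p s s' t → Runs q s' s'' t' → Runs (.seq p q) s s'' (t + t')
  | iteTrue {e : Expr} {p q : Prog} {s s' : State} {t : ℕ} :
      e.eval s ≠ 0 → Runs p s s' t → Runs (.ite e p q) s s' (e.cost + 1 + t)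
  | iteFalse {e : Expr} {p q : Prog} {s s' : State} {t : ℕ} :
      e.eval s = 0 → Runs q s s' t → Runs (.ite e p q) s s' (e.cost + 1 + t)
  | loopTrue {e : Expr} {p : Prog} {s s' s'' : State} {t t' : ℕ} :
      e.eval s ≠ 0 → Runs p s s' t → Runs (.loop e p) s' s'' t' →
        Runs (.loop e p) s s'' (e.cost + 1 + t + t')
  | loopFalse {e : Expr} {p : Prog} {s : State} :
      e.eval s = 0 → Runs (.loop e p) s s (e.cost + 1)

/-- Programs are deterministic. -/
theorem Runs.deterministic {p : Prog} {s s₁ s₂ : State} {t₁ t₂ : ℕ}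
    (h₁ : Runs p s s₁ t₁) (h₂ : Runs p s s₂ t₂) : s₁ = s₂ ∧ t₁ = t₂ := by
  induction h₁ generalizing s₂ t₂ with
  | skip | assign | write => cases h₂; exact ⟨rfl, rfl⟩
  | seq _ _ ih ih' =>
    cases h₂ with
    | seq g g' =>
      obtain ⟨rfl, rfl⟩ := ih g
      obtain ⟨rfl, rfl⟩ := ih' g'
      exact ⟨rfl, rfl⟩
  | iteTrue he _ ih =>
    cases h₂ with
    | iteTrue _ g => obtain ⟨rfl, rfl⟩ := ih g; exact ⟨rfl, rfl⟩
    | iteFalse h _ => exact absurd h he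
  | iteFalse he _ ih =>
    cases h₂ with
    | iteTrue h _ => exact absurd he h
    | iteFalse _ g => obtain ⟨rfl, rfl⟩ := ih g; exact ⟨rfl, rfl⟩
  | loopTrue he _ _ ih ih' =>
    cases h₂ with
    | loopTrue _ g g' =>
      obtain ⟨rfl, rfl⟩ := ih g
      obtain ⟨rfl, rfl⟩ := ih' g'
      exact ⟨rfl, rfl⟩
    | loopFalse h => exact absurd h he
  | loopFalse he =>
    cases h₂ with
    | loopTrue h _ _ => exact absurd he h
    | loopFalse _ => exact ⟨rfl, rfl⟩

/-- The initial state on the input `w`: the input stands in array `0`, its length in variable `0`,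
and everything else is zero. -/
def State.init (w : List ℕ) : State where
  var x := if x = 0 then w.length else 0
  arr a i := if a = 0 then w.getD i 0 else 0

/-- The length of the encoding of a sequence of natural numbers: all numbers are written in binary,
each followed by a separator. -/
def inputLength (w : List ℕ) : ℕ := (w.map fun x => Nat.size x + 1).sum

/-! ### Fixed-parameter tractability -/

/-- A parameterized decision problem on instances of type `α`. -/
structure ParamProblem (α : Type) where
  encode : α → List ℕ
  param : α → ℕ
  yes : α → Prop

/-- A parameterized problem is in FPT if one program decides it (the answer is in variable `0`:
`1` for yes and `0` for no) within `f(k) * |I|^c` steps, where `k` is the parameter and `|I|` the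
length of the encoding of the instance, for a computable function `f` and a constant `c`. -/
def ParamProblem.InFPT {α : Type} (P : ParamProblem α) : Prop :=
  ∃ (p : Prog) (f : ℕ → ℕ) (c : ℕ), Computable f ∧
    ∀ I : α, ∃ (s : State) (t : ℕ), Runs p (State.init (P.encode I)) s t ∧
      t ≤ f (P.param I) * inputLength (P.encode I) ^ c ∧
      (P.yes I → s.var 0 = 1) ∧ (¬ P.yes I → s.var 0 = 0)

/-- Robustness Radius for the rule `R`, parameterized by the number of voters. -/
def robustnessRadiusByVoters (R : MultiwinnerRule) : ParamProblem Instance where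
  encode := Instance.encode
  param := Instance.n
  yes := RobustnessRadius R

end RobustCC

/-! A voter's contribution is `m - 1` minus the rank (counted from `0`) of the best committee
member, so winning committees are those of least total best rank (`mem_betaCC_iff`). The degenerate
cases are `k = 0`, `k ≥ m`, no swaps and no voters; in them the outcome cannot change. Otherwise let
the tops be the candidates ranked first by somebody.

With fewer than `k` tops, the winners are the size-`k` supersets of the set of tops, so the outcome
changes exactly when this set does. The cheapest way is to lift one new candidate to the top of one
vote, or to depose one top candidate by one swap in every vote that it leads
(`change_iff_of_few_tops`).

With at least `k` tops, fix a winning committee `S`. A change means essentially that a committee `T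
≠ S` catches up with `S`. A swap changes the gap between a representative `t` of `T` and the best of
`S` by one, except the swap in which `t` passes the best of `S`, which changes it by two. Hence `b`
swaps in a vote gain at most `b`, plus one if `t` overtakes there (`VoteReach.gain_le`). If `U` is
the set of voters with an overtaking, the two conditions are that the overtakings are affordable and
that the total deficit is at most `B + |U|`; they are also sufficient (`change_iff_of_many_tops`).
If `T` is tied with `S` from the start, one swap breaks the tie, thanks to the number of tops.

The representatives are found by guessing the clustering of the voters by representative, the set
`U`, the member `s` of `S` missing from `T`, and for each cluster the excess of the representative's
rank sum over the least possible one. If the least rank sums already fit the budget, no overtaking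
is needed. If not, the excesses add up to less than `|U| ≤ n`. So clusterings, marks and excesses
all have values at most `n`, and at most `(n + 1) ^ n` codes of each kind suffice. Once they are
fixed, the clusters are independent, and each takes the allowed candidate with the least marked rank
sum (`Lists.overtaken`, `Lists.exists_overtaking`). `S` itself comes from a cheapest clustering
(`Lists.leaders_mem_betaCC`).

For the running time, the criterion is written in a language of arithmetic terms whose loops are all
cut off at a global bound `G`. Every fixed term compiles to a program with time polynomial in `G`
(`Tm.exists_spec`), and `G` can be taken as a function of `n` times a power of the input length. -/

namespace RobustCC

/-! ### Termination with a postcondition and a time bound -/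

/-- Started in `s`, the program `p` stops within `T` steps in a state that satisfies `Q`. -/
def Ends (p : Prog) (s : State) (T : ℕ) (Q : State → Prop) : Prop :=
  ∃ s' t, Runs p s s' t ∧ t ≤ T ∧ Q s'

theorem Ends.mono {p : Prog} {s : State} {T T' : ℕ} {Q Q' : State → Prop} (h : Ends p s T Q)
    (hT : T ≤ T') (hQ : ∀ s', Q s' → Q' s') : Ends p s T' Q' := by
  obtain ⟨s', t, hr, ht, hq⟩ := h
  exact ⟨s', t, hr, ht.trans hT, hQ _ hq⟩

theorem Ends.seq {p q : Prog} {s : State} {T₁ T₂ : ℕ} {R Q : State → Prop} (h : Ends p s T₁ R)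
    (h' : ∀ s', R s' → Ends q s' T₂ Q) : Ends (.seq p q) s (T₁ + T₂) Q := by
  obtain ⟨s', t, hr, ht, hq⟩ := h
  obtain ⟨s'', t', hr', ht', hq'⟩ := h' s' hq
  exact ⟨s'', _, Runs.seq hr hr', by omega, hq'⟩

theorem Ends.assign {x : ℕ} {e : Expr} {s : State} {Q : State → Prop}
    (h : Q (s.setVar x (e.eval s))) : Ends (.assign x e) s (e.cost + 1) Q :=
  ⟨_, _, Runs.assign x e s, le_rfl, h⟩

theorem Ends.assign_seq {x : ℕ} {e : Expr} {q : Prog} {s : State} {T : ℕ} {Q : State → Prop}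
    (h : Ends q (s.setVar x (e.eval s)) T Q) :
    Ends (.seq (.assign x e) q) s (e.cost + 1 + T) Q :=
  (Ends.assign rfl).seq fun s' (hs : _ = s') => hs ▸ h

/-- A loop with an invariant that is indexed by the number of the remaining rounds. -/
theorem Ends.loop {e : Expr} {p : Prog} {T : ℕ} (J : ℕ → State → Prop)
    (h0 : ∀ s, J 0 s → e.eval s = 0)
    (h1 : ∀ r s, J (r + 1) s → e.eval s ≠ 0 ∧ Ends p s T (J r)) (r : ℕ) :
    ∀ s, J r s → Ends (.loop e p) s (r * (e.cost + 1 + T) + (e.cost + 1)) (J 0) := by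
  induction r with
  | zero => exact fun s hs => ⟨s, _, Runs.loopFalse (h0 s hs), by omega, hs⟩
  | succ r ih =>
    intro s hs
    obtain ⟨he, s', t, hr, ht, hq⟩ := h1 r s hs
    obtain ⟨s'', t', hr', ht', hq'⟩ := ih s' hq
    refine ⟨s'', _, Runs.loopTrue he hr hr', ?_, hq'⟩
    rw [Nat.succ_mul]
    omega

/-! ### Terms with bounded sums and bounded iteration -/

/-- Terms of arithmetic with bounded summation and bounded iteration over a read-only input.
The number of rounds of each `sum` and each `iter` is cut off at a global bound. -/
inductive Tm where
  | const (c : ℕ)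
  | var (x : ℕ)
  | bound
  | add (a b : Tm)
  | sub (a b : Tm)
  | inp (a : Tm)
  | sum (x : ℕ) (N b : Tm)
  | iter (x : ℕ) (N a b : Tm)

/-- The value of a term for the input `w`, the global bound `G` and the values `e` of the
variables. -/
def Tm.eval (w : ℕ → ℕ) (G : ℕ) : Tm → (ℕ → ℕ) → ℕ
  | const c, _ => c
  | var x, e => e x
  | bound, _ => G
  | add a b, e => a.eval w G e + b.eval w G e
  | sub a b, e => a.eval w G e - b.eval w G e
  | inp a, e => w (a.eval w G e)
  | sum x N b, e =>
      ∑ i ∈ Finset.range (min (N.eval w G e) G), b.eval w G (Function.update e x i)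
  | iter x N a b, e =>
      (fun y => b.eval w G (Function.update e x y))^[min (N.eval w G e) G] (a.eval w G e)

/-- The program that computes a term. The variable `x` of terms is the machine variable `2 * x`,
the global bound is in the machine variable `1`, the result is put into the machine variable
`2 * d + 1`, and of the odd machine variables only those from there on are used. -/
def Tm.prog : Tm → ℕ → Prog
  | const c, d => .assign (2 * d + 1) (.const c)
  | var x, d => .assign (2 * d + 1) (.var (2 * x))
  | bound, d => .assign (2 * d + 1) (.var 1)
  | add a b, d => .seq (a.prog d) (.seq (b.prog (d + 1))
      (.assign (2 * d + 1) (.add (.var (2 * d + 1)) (.var (2 * (d + 1) + 1)))))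
  | sub a b, d => .seq (a.prog d) (.seq (b.prog (d + 1))
      (.assign (2 * d + 1) (.sub (.var (2 * d + 1)) (.var (2 * (d + 1) + 1)))))
  | inp a, d => .seq (a.prog d) (.assign (2 * d + 1) (.read 0 (.var (2 * d + 1))))
  | sum x N b, d =>
      .seq (N.prog d) <|
      .seq (.assign (2 * d + 1) (.sub (.var (2 * d + 1)) (.sub (.var (2 * d + 1)) (.var 1)))) <|
      .seq (.assign (2 * (d + 1) + 1) (.var (2 * x))) <|
      .seq (.assign (2 * (d + 2) + 1) (.const 0)) <|
      .seq (.assign (2 * x) (.const 0)) <|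
      .seq (.loop (.sub (.var (2 * d + 1)) (.var (2 * x)))
        (.seq (b.prog (d + 3))
        (.seq (.assign (2 * (d + 2) + 1)
          (.add (.var (2 * (d + 2) + 1)) (.var (2 * (d + 3) + 1))))
        (.assign (2 * x) (.add (.var (2 * x)) (.const 1)))))) <|
      .seq (.assign (2 * x) (.var (2 * (d + 1) + 1)))
      (.assign (2 * d + 1) (.var (2 * (d + 2) + 1)))
  | iter x N a b, d =>
      .seq (N.prog d) <|
      .seq (.assign (2 * d + 1) (.sub (.var (2 * d + 1)) (.sub (.var (2 * d + 1)) (.var 1)))) <|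
      .seq (a.prog (d + 1)) <|
      .seq (.assign (2 * (d + 2) + 1) (.var (2 * x))) <|
      .seq (.assign (2 * x) (.var (2 * (d + 1) + 1))) <|
      .seq (.loop (.var (2 * d + 1))
        (.seq (b.prog (d + 3))
        (.seq (.assign (2 * x) (.var (2 * (d + 3) + 1)))
        (.assign (2 * d + 1) (.sub (.var (2 * d + 1)) (.const 1)))))) <|
      .seq (.assign (2 * d + 1) (.var (2 * x)))
      (.assign (2 * x) (.var (2 * (d + 2) + 1)))

/-! ### Correctness and running time of the compiled terms. -/

/-- `s'` agrees with `s` on the arrays, on the variables of terms, and on the odd machine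
variables below `2 * d + 1`. -/
structure Agree (d : ℕ) (s s' : State) : Prop where
  arr : s'.arr = s.arr
  even : ∀ x, s'.var (2 * x) = s.var (2 * x)
  odd : ∀ i < d, s'.var (2 * i + 1) = s.var (2 * i + 1)

/-- The values of the variables of terms in a machine state. -/
def State.names (s : State) (x : ℕ) : ℕ := s.var (2 * x)

theorem Agree.names {d : ℕ} {s s' : State} (h : Agree d s s') : s'.names = s.names :=
  funext h.even

theorem State.var_setVar_self (s : State) (x a : ℕ) : (s.setVar x a).var x = a := by
  simp [State.setVar]

theorem State.var_setVar_of_ne (s : State) {x y : ℕ} (a : ℕ) (h : y ≠ x) :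
    (s.setVar x a).var y = s.var y := by
  simp [State.setVar, h]

theorem State.arr_setVar (s : State) (x a : ℕ) : (s.setVar x a).arr = s.arr := rfl

/-- The specification of the program of the term `t`. -/
def Tm.Spec (t : Tm) (K D : ℕ) : Prop :=
  -- The slot `d = 0` would be machine variable `1`, which holds the global bound; hence `0 < d`.
  ∀ d s, 0 < d → Ends (t.prog d) s (K * (s.var 1 + 1) ^ D) fun s' =>
    Agree d s s' ∧ s'.var (2 * d + 1) = t.eval (s.arr 0) (s.var 1) s.names

theorem Tm.Spec.leaf {t : Tm} {e : Expr} (hp : ∀ d, t.prog d = .assign (2 * d + 1) e)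
    (he : ∀ s, e.eval s = t.eval (s.arr 0) (s.var 1) s.names) : t.Spec (e.cost + 1) 0 := by
  intro d s hd
  rw [hp, pow_zero, mul_one]
  refine Ends.assign ⟨⟨rfl, fun x => State.var_setVar_of_ne _ _ (by omega), fun i hi =>
    State.var_setVar_of_ne _ _ (by omega)⟩, ?_⟩
  rw [State.var_setVar_self, he]

/-- Keeps time bounds of the form `K * (g + 1) ^ D` closed under sequential composition, by adding
both the coefficients and the exponents. -/
theorem bound_add {g K₁ D₁ K₂ D₂ : ℕ} :
    K₁ * (g + 1) ^ D₁ + K₂ * (g + 1) ^ D₂ ≤ (K₁ + K₂) * (g + 1) ^ (D₁ + D₂) := by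
  have h1 : (g + 1) ^ D₁ ≤ (g + 1) ^ (D₁ + D₂) := Nat.pow_le_pow_right (by omega) (by omega)
  have h2 : (g + 1) ^ D₂ ≤ (g + 1) ^ (D₁ + D₂) := Nat.pow_le_pow_right (by omega) (by omega)
  rw [add_mul]
  gcongr

theorem Agree.var_one {d : ℕ} {s s' : State} (h : Agree d s s') (hd : 0 < d) :
    s'.var 1 = s.var 1 := h.odd 0 hd

/-- The second operand is computed one slot higher, so the first result survives in slot `d`. -/
theorem Tm.Spec.binary {a b t : Tm} {f : ℕ → ℕ → ℕ} {op : Expr → Expr → Expr} {K₁ D₁ K₂ D₂ : ℕ}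
    (ha : a.Spec K₁ D₁) (hb : b.Spec K₂ D₂)
    (hp : ∀ d, t.prog d = .seq (a.prog d) (.seq (b.prog (d + 1))
      (.assign (2 * d + 1) (op (.var (2 * d + 1)) (.var (2 * (d + 1) + 1))))))
    (hop : ∀ e e' s, (op e e').eval s = f (e.eval s) (e'.eval s))
    (hcost : ∀ e e', (op e e').cost = e.cost + e'.cost + 1)
    (ht : ∀ w G e, t.eval w G e = f (a.eval w G e) (b.eval w G e)) :
    t.Spec (K₁ + (K₂ + 4)) (D₁ + (D₂ + 0)) := by
  intro d s hd
  rw [hp]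
  refine (Ends.seq (ha d s hd) (T₂ := (K₂ + 4) * (s.var 1 + 1) ^ (D₂ + 0)) ?_).mono bound_add
    (fun _ h => h)
  rintro s₁ ⟨h₁, v₁⟩
  have e1 := h₁.var_one hd
  refine (Ends.seq (T₂ := 4 * (s.var 1 + 1) ^ 0) (e1 ▸ hb (d + 1) s₁ (by omega)) ?_).mono
    bound_add (fun _ h => h)
  rintro s₂ ⟨h₂, v₂⟩
  refine (Ends.assign ?_).mono (by simp [hcost, Expr.cost]) (fun _ h => h)
  refine ⟨⟨?_, fun x => ?_, fun i hi => ?_⟩, ?_⟩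
  · rw [State.arr_setVar, h₂.arr, h₁.arr]
  · rw [State.var_setVar_of_ne _ _ (by omega), h₂.even, h₁.even]
  · rw [State.var_setVar_of_ne _ _ (by omega), h₂.odd _ (by omega), h₁.odd _ hi]
  · rw [State.var_setVar_self, ht, hop, Expr.eval, Expr.eval, v₂, h₂.odd d (by omega), v₁,
      h₁.arr, h₁.names]

theorem Tm.Spec.inp {a : Tm} {K D : ℕ} (ha : a.Spec K D) : (Tm.inp a).Spec (K + 3) (D + 0) := by
  intro d s hd
  refine (Ends.seq (ha d s hd) (T₂ := 3 * (s.var 1 + 1) ^ 0) ?_).mono bound_add (fun _ h => h)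
  rintro s₁ ⟨h₁, v₁⟩
  refine (Ends.assign ?_).mono (by simp [Expr.cost]) (fun _ h => h)
  refine ⟨⟨h₁.arr, fun x => ?_, fun i hi => ?_⟩, ?_⟩
  · rw [State.var_setVar_of_ne _ _ (by omega), h₁.even]
  · rw [State.var_setVar_of_ne _ _ (by omega), h₁.odd _ hi]
  · rw [State.var_setVar_self, Expr.eval, Expr.eval, v₁, h₁.arr]
    rfl

/-- At most `g` rounds raise the exponent by one; the base `g + 1` also pays for the last, failing
test. -/
theorem bound_loop {g M T c K D : ℕ} (hM : M ≤ g) (hT : T ≤ K * (g + 1) ^ D) :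
    M * (c + T) + c ≤ (c + K) * (g + 1) ^ (D + 1) := by
  have h1 : 1 ≤ (g + 1) ^ D := Nat.one_le_pow _ _ (by omega)
  calc M * (c + T) + c ≤ g * (c + T) + (c + T) := by gcongr; omega
    _ = (c + T) * (g + 1) := by ring
    _ ≤ (c * (g + 1) ^ D + K * (g + 1) ^ D) * (g + 1) := by gcongr; exact Nat.le_mul_of_pos_right _ h1
    _ = _ := by ring

/-- This is how the machine cuts off the number of rounds at the global bound. -/
theorem sub_sub_eq_min (a b : ℕ) : a - (a - b) = min a b := by omega

/-- Slot `d` holds the number of rounds, `d + 1` the old value of `x`, `d + 2` the partial sum, and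
the body works from `d + 3` on. Restoring `x` at the end leaves all term variables unchanged, as
`Agree` requires. -/
theorem Tm.Spec.sum {x : ℕ} {N b : Tm} {K₁ D₁ K₂ D₂ : ℕ} (hN : N.Spec K₁ D₁)
    (hb : b.Spec K₂ D₂) : ∃ K D, (Tm.sum x N b).Spec K D := by
  refine ⟨K₁ + (20 + (4 + (K₂ + 8))), D₁ + (0 + (D₂ + 0 + 1)), fun d s hd => ?_⟩
  set g := s.var 1 with hg
  set M := min (N.eval (s.arr 0) g s.names) g with hM
  set F : ℕ → ℕ := fun i => b.eval (s.arr 0) g (Function.update s.names x i) with hF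
  refine (Ends.seq (hN d s hd)
    (T₂ := (20 + (4 + (K₂ + 8))) * (g + 1) ^ (0 + (D₂ + 0 + 1))) ?_).mono bound_add (fun _ h => h)
  rintro s₁ ⟨h₁, v₁⟩
  have e1 := h₁.var_one hd
  -- Here `r` rounds remain, and `x` itself counts the `i` finished ones.
  let J : ℕ → State → Prop := fun r s' => ∃ i, i + r = M ∧ s'.arr = s.arr ∧
    (∀ y, s'.names y = Function.update s.names x i y) ∧
    (∀ j < d, s'.var (2 * j + 1) = s.var (2 * j + 1)) ∧
    s'.var (2 * d + 1) = M ∧ s'.var (2 * (d + 1) + 1) = s.names x ∧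
    s'.var (2 * (d + 2) + 1) = ∑ i ∈ Finset.range i, F i
  have hloop : ∀ s', J M s' → Ends (.loop (.sub (.var (2 * d + 1)) (.var (2 * x)))
        (.seq (b.prog (d + 3))
        (.seq (.assign (2 * (d + 2) + 1)
          (.add (.var (2 * (d + 2) + 1)) (.var (2 * (d + 3) + 1))))
        (.assign (2 * x) (.add (.var (2 * x)) (.const 1)))))) s'
      ((4 + (K₂ + 8)) * (g + 1) ^ (D₂ + 0 + 1)) (J 0) := by
    intro s' hs'
    refine (Ends.loop (T := K₂ * (g + 1) ^ D₂ + 8 * (g + 1) ^ 0) J ?_ ?_ M s' hs').mono ?_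
      (fun _ h => h)
    · rintro s' ⟨i, hi, -, hn, -, hd', -⟩
      have := hn x
      simp only [State.names, Function.update_self] at this
      simp [Expr.eval, hd', this, ← hi]
    · rintro r s' ⟨i, hi, ha, hn, ho, hd', hsv, hacc⟩
      have hx := hn x
      simp only [State.names, Function.update_self] at hx
      have h1' : s'.var 1 = g := ho 0 hd
      refine ⟨by simp [Expr.eval, hd', hx]; omega, ?_⟩
      refine Ends.seq (h1' ▸ hb (d + 3) s' (by omega)) ?_
      rintro s₂ ⟨h₂, v₂⟩
      refine (Ends.assign_seq (T := 4) ?_).mono (by simp [Expr.cost]) (fun _ h => h)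
      refine (Ends.assign ?_).mono (by simp [Expr.cost]) (fun _ h => h)
      refine ⟨i + 1, by omega, by rw [State.arr_setVar, State.arr_setVar, h₂.arr, ha], ?_, ?_, ?_,
        ?_, ?_⟩
      · intro y
        by_cases hy : y = x
        · subst hy
          simp only [State.names, State.var_setVar_self, Function.update_self, Expr.eval]
          rw [State.var_setVar_of_ne _ _ (by omega), h₂.even, hx]
        · have := hn y
          simp only [State.names, Function.update_of_ne hy] at this ⊢
          rw [State.var_setVar_of_ne _ _ (by omega), State.var_setVar_of_ne _ _ (by omega),
            h₂.even, this]
      · intro j hj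
        rw [State.var_setVar_of_ne _ _ (by omega), State.var_setVar_of_ne _ _ (by omega),
          h₂.odd _ (by omega), ho _ hj]
      · rw [State.var_setVar_of_ne _ _ (by omega), State.var_setVar_of_ne _ _ (by omega),
          h₂.odd _ (by omega), hd']
      · rw [State.var_setVar_of_ne _ _ (by omega), State.var_setVar_of_ne _ _ (by omega),
          h₂.odd _ (by omega), hsv]
      · rw [State.var_setVar_of_ne _ _ (by omega), State.var_setVar_self, Expr.eval, Expr.eval,
          Expr.eval, v₂, h₂.odd _ (by omega), hacc, Finset.sum_range_succ, ha, funext hn]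
    · refine bound_loop (min_le_right _ _) ?_
      exact bound_add
  refine (Ends.assign_seq (T := 2 + (2 + (2 + ((4 + (K₂ + 8)) * (g + 1) ^ (D₂ + 0 + 1) + 4))))
    ?_).mono (T' := _) ?_ (fun _ h => h)
  swap
  · have h1 : 1 ≤ (g + 1) ^ (D₂ + 0 + 1) := Nat.one_le_pow _ _ (by omega)
    rw [zero_add, add_mul 20]
    simp only [Expr.cost]
    omega
  refine Ends.assign_seq ?_
  refine Ends.assign_seq ?_
  refine Ends.seq (Ends.assign ?_) (R := J M) ?_
  · refine ⟨0, by omega, h₁.arr, ?_, ?_, ?_, ?_, ?_⟩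
    · intro y
      by_cases hy : y = x
      · subst hy
        simp [State.names, State.var_setVar_self, Expr.eval]
      · have := h₁.even y
        simp only [State.names, Function.update_of_ne hy] at this ⊢
        rw [State.var_setVar_of_ne _ _ (by omega), State.var_setVar_of_ne _ _ (by omega),
          State.var_setVar_of_ne _ _ (by omega), State.var_setVar_of_ne _ _ (by omega), this]
    · intro j hj
      rw [State.var_setVar_of_ne _ _ (by omega), State.var_setVar_of_ne _ _ (by omega),
        State.var_setVar_of_ne _ _ (by omega), State.var_setVar_of_ne _ _ (by omega), h₁.odd _ hj]
    · rw [State.var_setVar_of_ne _ _ (by omega), State.var_setVar_of_ne _ _ (by omega),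
        State.var_setVar_of_ne _ _ (by omega), State.var_setVar_self]
      simp only [Expr.eval, sub_sub_eq_min, v₁, e1, hM, ← hg]
    · rw [State.var_setVar_of_ne _ _ (by omega), State.var_setVar_of_ne _ _ (by omega),
        State.var_setVar_self]
      simp only [Expr.eval]
      rw [State.var_setVar_of_ne _ _ (by omega), h₁.even]
      rfl
    · rw [State.var_setVar_of_ne _ _ (by omega), State.var_setVar_self]
      simp [Expr.eval]
  intro s₂ hs₂
  refine Ends.seq (hloop _ hs₂) ?_
  rintro s₃ ⟨i, hi, ha, hn, ho, hd', hsv, hacc⟩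
  refine Ends.assign_seq (T := 2) ?_
  refine Ends.assign ⟨⟨ha, ?_, ?_⟩, ?_⟩
  · intro y
    rw [State.var_setVar_of_ne _ _ (by omega)]
    by_cases hy : y = x
    · subst hy
      rw [State.var_setVar_self, Expr.eval, hsv]
      rfl
    · have := hn y
      simp only [State.names, Function.update_of_ne hy] at this
      rw [State.var_setVar_of_ne _ _ (by omega), this]
  · intro j hj
    rw [State.var_setVar_of_ne _ _ (by omega), State.var_setVar_of_ne _ _ (by omega), ho _ hj]
  · rw [State.var_setVar_self, Expr.eval, State.var_setVar_of_ne _ _ (by omega), hacc,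
      show i = M by omega]
    rfl

/-- Slot `d` counts down the rounds, `x` carries the current iterate, and slot `d + 2` keeps the old
value of `x`. -/
theorem Tm.Spec.iter {x : ℕ} {N a b : Tm} {K₁ D₁ K₂ D₂ K₃ D₃ : ℕ} (hN : N.Spec K₁ D₁)
    (ha : a.Spec K₂ D₂) (hb : b.Spec K₃ D₃) : ∃ K D, (Tm.iter x N a b).Spec K D := by
  refine ⟨K₁ + (6 + (K₂ + (8 + (2 + (K₃ + 6))))), D₁ + (0 + (D₂ + (0 + (D₃ + 0 + 1)))),
    fun d s hd => ?_⟩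
  set g := s.var 1 with hg
  set M := min (N.eval (s.arr 0) g s.names) g with hM
  set F : ℕ → ℕ := fun i => b.eval (s.arr 0) g (Function.update s.names x i) with hF
  refine (Ends.seq (hN d s hd) ?_
    (T₂ := (6 + (K₂ + (8 + (2 + (K₃ + 6))))) * (g + 1) ^ (0 + (D₂ + (0 + (D₃ + 0 + 1)))))).mono
    bound_add (fun _ h => h)
  rintro s₁ ⟨h₁, v₁⟩
  have e1 := h₁.var_one hd
  let J : ℕ → State → Prop := fun r s' => ∃ i, i + r = M ∧ s'.arr = s.arr ∧
    (∀ y, s'.names y =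
      Function.update s.names x (F^[i] (a.eval (s.arr 0) g s.names)) y) ∧
    (∀ j < d, s'.var (2 * j + 1) = s.var (2 * j + 1)) ∧
    s'.var (2 * d + 1) = r ∧ s'.var (2 * (d + 2) + 1) = s.names x
  have hloop : ∀ s', J M s' → Ends (.loop (.var (2 * d + 1))
        (.seq (b.prog (d + 3))
        (.seq (.assign (2 * x) (.var (2 * (d + 3) + 1)))
        (.assign (2 * d + 1) (.sub (.var (2 * d + 1)) (.const 1)))))) s'
      ((2 + (K₃ + 6)) * (g + 1) ^ (D₃ + 0 + 1)) (J 0) := by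
    intro s' hs'
    refine (Ends.loop (T := K₃ * (g + 1) ^ D₃ + 6 * (g + 1) ^ 0) J ?_ ?_ M s' hs').mono ?_
      (fun _ h => h)
    · rintro s' ⟨i, hi, -, hn, -, hd', -⟩
      simp [Expr.eval, hd']
    · rintro r s' ⟨i, hi, ha, hn, ho, hd', hsv⟩
      have h1' : s'.var 1 = g := ho 0 hd
      refine ⟨by simp [Expr.eval, hd'], ?_⟩
      refine Ends.seq (h1' ▸ hb (d + 3) s' (by omega)) ?_
      rintro s₂ ⟨h₂, v₂⟩
      refine (Ends.assign_seq (T := 4) ?_).mono (by simp [Expr.cost]) (fun _ h => h)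
      refine (Ends.assign ?_).mono (by simp [Expr.cost]) (fun _ h => h)
      refine ⟨i + 1, by omega, by rw [State.arr_setVar, State.arr_setVar, h₂.arr, ha], ?_, ?_, ?_,
        ?_⟩
      · intro y
        by_cases hy : y = x
        · subst hy
          simp only [State.names, Function.update_self, Expr.eval]
          rw [State.var_setVar_of_ne _ _ (by omega), State.var_setVar_self, v₂, ha,
            funext hn, Function.iterate_succ_apply']
        · have := hn y
          simp only [State.names, Function.update_of_ne hy] at this ⊢
          rw [State.var_setVar_of_ne _ _ (by omega), State.var_setVar_of_ne _ _ (by omega),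
            h₂.even, this]
      · intro j hj
        rw [State.var_setVar_of_ne _ _ (by omega), State.var_setVar_of_ne _ _ (by omega),
          h₂.odd _ (by omega), ho _ hj]
      · rw [State.var_setVar_self]
        simp only [Expr.eval]
        rw [State.var_setVar_of_ne _ _ (by omega), h₂.odd _ (by omega), hd']
        rfl
      · rw [State.var_setVar_of_ne _ _ (by omega), State.var_setVar_of_ne _ _ (by omega),
          h₂.odd _ (by omega), hsv]
    · exact bound_loop (min_le_right _ _) bound_add
  refine (Ends.assign_seq (T := K₂ * (g + 1) ^ D₂ +
    (2 + (2 + ((2 + (K₃ + 6)) * (g + 1) ^ (D₃ + 0 + 1) + 4)))) ?_).mono (T' := _) ?_ (fun _ h => h)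
  swap
  · refine le_trans (add_le_add (b := 6 * (g + 1) ^ 0) (by simp [Expr.cost]) ?_) bound_add
    refine le_trans (add_le_add le_rfl ?_) bound_add
    refine le_trans (le_of_eq (by ring)) (bound_add (K₁ := 8) (D₁ := 0))
  have e2 : (s₁.setVar (2 * d + 1) M).var 1 = g := by
    rw [State.var_setVar_of_ne _ _ (by omega), e1]
  have n2 : (s₁.setVar (2 * d + 1) M).names = s.names := by
    funext y
    rw [State.names, State.var_setVar_of_ne _ _ (by omega), h₁.even]
    rfl
  have hM' : (Expr.sub (.var (2 * d + 1)) (.sub (.var (2 * d + 1)) (.var 1))).eval s₁ = M := by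
    simp only [Expr.eval, sub_sub_eq_min, v₁, e1, hM, ← hg]
  rw [hM']
  refine Ends.seq (e2 ▸ ha (d + 1) _ (by omega)) ?_
  rintro s₂ ⟨h₂, v₂⟩
  rw [State.arr_setVar, h₁.arr, n2] at v₂
  refine Ends.assign_seq ?_
  refine Ends.seq (Ends.assign ?_) (R := J M) ?_
  · refine ⟨0, by omega, by simp only [State.arr_setVar, h₂.arr, h₁.arr], ?_, ?_, ?_, ?_⟩
    · intro y
      by_cases hy : y = x
      · subst hy
        simp only [State.names, State.var_setVar_self, Expr.eval, Function.update_self]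
        rw [State.var_setVar_of_ne _ _ (by omega), v₂]
        rfl
      · have := congrFun n2 y
        simp only [State.names, Function.update_of_ne hy] at this ⊢
        rw [State.var_setVar_of_ne _ _ (by omega), State.var_setVar_of_ne _ _ (by omega),
          h₂.even, this]
    · intro j hj
      rw [State.var_setVar_of_ne _ _ (by omega), State.var_setVar_of_ne _ _ (by omega),
        h₂.odd _ (by omega), State.var_setVar_of_ne _ _ (by omega), h₁.odd _ hj]
    · rw [State.var_setVar_of_ne _ _ (by omega), State.var_setVar_of_ne _ _ (by omega),
        h₂.odd _ (by omega), State.var_setVar_self]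
    · rw [State.var_setVar_of_ne _ _ (by omega), State.var_setVar_self]
      simp only [Expr.eval]
      rw [h₂.even]
      exact congrFun n2 x
  intro s₃ hs₃
  refine Ends.seq (hloop _ hs₃) ?_
  rintro s₄ ⟨i, hi, ha, hn, ho, hd', hsv⟩
  refine Ends.assign_seq (T := 2) ?_
  refine Ends.assign ⟨⟨ha, ?_, ?_⟩, ?_⟩
  · intro y
    by_cases hy : y = x
    · subst hy
      rw [State.var_setVar_self, Expr.eval, State.var_setVar_of_ne _ _ (by omega), hsv]
      rfl
    · have := hn y
      simp only [State.names, Function.update_of_ne hy] at this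
      rw [State.var_setVar_of_ne _ _ (by omega), State.var_setVar_of_ne _ _ (by omega), this]
  · intro j hj
    rw [State.var_setVar_of_ne _ _ (by omega), State.var_setVar_of_ne _ _ (by omega), ho _ hj]
  · have := hn x
    rw [State.var_setVar_of_ne _ _ (by omega), State.var_setVar_self, Expr.eval]
    simp only [State.names, Function.update_self] at this
    rw [this, show i = M by omega]
    rfl

/-- Every term is computed in time polynomial in the global bound. -/
theorem Tm.exists_spec (t : Tm) : ∃ K D, t.Spec K D := by
  induction t with
  | const c => exact ⟨_, _, Tm.Spec.leaf (e := .const c) (fun _ => rfl) (fun _ => rfl)⟩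
  | var x => exact ⟨_, _, Tm.Spec.leaf (e := .var (2 * x)) (fun _ => rfl) (fun _ => rfl)⟩
  | bound => exact ⟨_, _, Tm.Spec.leaf (e := .var 1) (fun _ => rfl) (fun _ => rfl)⟩
  | add a b iha ihb =>
    obtain ⟨_, _, ha⟩ := iha
    obtain ⟨_, _, hb⟩ := ihb
    exact ⟨_, _, Tm.Spec.binary (op := .add) ha hb (fun _ => rfl) (fun _ _ _ => rfl)
      (fun _ _ => rfl) (fun _ _ _ => rfl)⟩
  | sub a b iha ihb =>
    obtain ⟨_, _, ha⟩ := iha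
    obtain ⟨_, _, hb⟩ := ihb
    exact ⟨_, _, Tm.Spec.binary (op := .sub) ha hb (fun _ => rfl) (fun _ _ _ => rfl)
      (fun _ _ => rfl) (fun _ _ _ => rfl)⟩
  | inp a iha =>
    obtain ⟨_, _, ha⟩ := iha
    exact ⟨_, _, ha.inp⟩
  | sum x N b ihN ihb =>
    obtain ⟨_, _, hN⟩ := ihN
    obtain ⟨_, _, hb⟩ := ihb
    exact hN.sum hb
  | iter x N a b ihN iha ihb =>
    obtain ⟨_, _, hN⟩ := ihN
    obtain ⟨_, _, ha⟩ := iha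
    obtain ⟨_, _, hb⟩ := ihb
    exact hN.iter ha hb

end RobustCC

namespace RobustCC

open Function (update)

/-! ### Logical operations on terms -/

open Classical in
/-- The truth value of a proposition as a number. -/
noncomputable def ind (P : Prop) : ℕ := if P then 1 else 0

theorem ind_eq_zero {P : Prop} : ind P = 0 ↔ ¬ P := by simp [ind]

theorem ind_le_one (P : Prop) : ind P ≤ 1 := by unfold ind; split_ifs <;> simp

theorem ind_of {P : Prop} (h : P) : ind P = 1 := by simp [ind, h]

theorem ind_of_not {P : Prop} (h : ¬ P) : ind P = 0 := by simp [ind, h]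

/-- The least number with property `P`, if there is one below `N`, and `N` otherwise. -/
noncomputable def leastBelow (N : ℕ) (P : ℕ → Prop) : ℕ :=
  ∑ r ∈ Finset.range N, ind (∀ q < r + 1, ¬ P q)

namespace Tm

def notT (a : Tm) : Tm := .sub (.const 1) a
def leT (a b : Tm) : Tm := notT (.sub a b)
def ltT (a b : Tm) : Tm := notT (leT b a)
def eqT (a b : Tm) : Tm := notT (.add (.sub a b) (.sub b a))
def andT (a b : Tm) : Tm := notT (.add (notT a) (notT b))
def orT (a b : Tm) : Tm := notT (notT (.add a b))
def exT (x : ℕ) (N a : Tm) : Tm := notT (notT (.sum x N a))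
def allT (x : ℕ) (N a : Tm) : Tm := notT (exT x N (notT a))
def letT (x : ℕ) (a b : Tm) : Tm := .iter x (.const 1) a b

/-- The term `a` if `p` is nonzero, and `0` otherwise (`a` must not use the variable `0`). -/
def ifT (p a : Tm) : Tm := .sum 0 (notT (notT p)) a

/-- The least value of `x` below `N` for which `p` is nonzero; `y` is an auxiliary variable. -/
def muT (x y : ℕ) (N p : Tm) : Tm := .sum y N (allT x (.add (.var y) (.const 1)) (notT p))

variable {w : ℕ → ℕ} {G : ℕ} {e : ℕ → ℕ}

theorem eval_notT (a : Tm) : (notT a).eval w G e = ind (a.eval w G e = 0) := by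
  simp only [notT, eval, ind]
  split_ifs <;> omega

theorem eval_leT (a b : Tm) : (leT a b).eval w G e = ind (a.eval w G e ≤ b.eval w G e) := by
  simp only [leT, eval_notT, eval, Nat.sub_eq_zero_iff_le]

theorem eval_ltT (a b : Tm) : (ltT a b).eval w G e = ind (a.eval w G e < b.eval w G e) := by
  simp only [ltT, eval_notT, eval_leT, ind_eq_zero, not_le]

theorem eval_eqT (a b : Tm) : (eqT a b).eval w G e = ind (a.eval w G e = b.eval w G e) := by
  simp only [eqT, eval_notT, eval]
  congr 1
  exact propext ⟨fun h => by omega, fun h => by omega⟩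

theorem eval_andT (a b : Tm) :
    (andT a b).eval w G e = ind (a.eval w G e ≠ 0 ∧ b.eval w G e ≠ 0) := by
  simp only [andT, eval_notT, eval, Nat.add_eq_zero_iff, ind_eq_zero, ne_eq]

theorem eval_orT (a b : Tm) :
    (orT a b).eval w G e = ind (a.eval w G e ≠ 0 ∨ b.eval w G e ≠ 0) := by
  simp only [orT, eval_notT, eval, Nat.add_eq_zero_iff, ind_eq_zero, ne_eq, not_and_or]

theorem eval_exT (x : ℕ) (N a : Tm) : (exT x N a).eval w G e =
    ind (∃ i < min (N.eval w G e) G, a.eval w G (update e x i) ≠ 0) := by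
  simp only [exT, eval_notT, eval, ind_eq_zero, Finset.sum_eq_zero_iff, Finset.mem_range,
    not_forall, exists_prop, ne_eq]

theorem eval_allT (x : ℕ) (N a : Tm) : (allT x N a).eval w G e =
    ind (∀ i < min (N.eval w G e) G, a.eval w G (update e x i) ≠ 0) := by
  simp only [allT, eval_notT, eval_exT, ind_eq_zero, not_exists, not_and, ne_eq, not_not]

/-- One round of an iteration is a substitution, provided that the cut-off admits one round. -/
theorem eval_letT (hG : 1 ≤ G) (x : ℕ) (a b : Tm) :
    (letT x a b).eval w G e = b.eval w G (update e x (a.eval w G e)) := by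
  simp [letT, eval, hG]

/-- The sum has one round or none, and in that round its variable `0` has the value `0`. -/
theorem eval_ifT (hG : 1 ≤ G) (p a : Tm) :
    (ifT p a).eval w G e = ind (p.eval w G e ≠ 0) * a.eval w G (update e 0 0) := by
  simp only [ifT, eval, eval_notT, ind_eq_zero]
  by_cases h : p.eval w G e = 0
  · simp [h, ind]
  · simp [h, ind, hG]

theorem eval_muT (x y : ℕ) (N p : Tm) : (muT x y N p).eval w G e =
    ∑ r ∈ Finset.range (min (N.eval w G e) G),
      ind (∀ q < r + 1, p.eval w G (update (update e y r) x q) = 0) := by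
  simp only [muT, eval]
  refine Finset.sum_congr rfl fun r hr => ?_
  -- Thus the inner quantifier over `q < r + 1` is not truncated.
  have hr' : r + 1 ≤ G := by
    have := Finset.mem_range.1 hr
    omega
  simp only [eval_allT, eval, eval_notT, Function.update_self, min_eq_left hr', ne_eq,
    ind_eq_zero, not_not]

end Tm

/-! ### The algorithm as a bounded formula

The input `w` starts with the number of voters, the number of candidates, the size of the
committees and the number of swaps. Functions on voters are encoded in base `w 0 + 1`. -/

section Formula

variable (w : ℕ → ℕ) (G : ℕ)

/-- The quotient of `y` and `w 0 + 1`, for `y < G`. -/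
noncomputable def quo (y : ℕ) : ℕ := leastBelow G fun q => y < (w 0 + 1) * (q + 1)

/-- The digit of `g` at place `v` in base `w 0 + 1`, for `g < G`. -/
noncomputable def digit (g v : ℕ) : ℕ :=
  (quo w G)^[min v G] g - (w 0 + 1) * quo w G ((quo w G)^[min v G] g)

/-- The candidate in vote `v` at place `i`. -/
def cand (v i : ℕ) : ℕ := w (4 + w 1 * v + i)

/-- The number of candidates above `c` in the vote `v`. -/
noncomputable def rk (v c : ℕ) : ℕ := leastBelow (w 1) fun i => cand w v i = c

/-- The sum of the ranks of `c` in the votes of cluster `j` of `φ`. -/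
noncomputable def clusterSum (φ j c : ℕ) : ℕ :=
  ∑ v ∈ Finset.range (w 0), ind (digit w G φ v = j) * rk w v c

/-- The least rank sum of a candidate other than `s` in cluster `j` of `φ`. -/
noncomputable def clusterMin (φ j s : ℕ) : ℕ :=
  leastBelow G fun x => ∃ c < w 1, c ≠ s ∧ clusterSum w G φ j c ≤ x

/-- `φ` assigns all voters to the clusters `0, …, w 2 - 1`. -/
def Clustering (φ : ℕ) : Prop := ∀ v < w 0, digit w G φ v < w 2

/-- The sum of the least rank sums of the clusters of `φ`. -/
noncomputable def clusterCost (φ : ℕ) : ℕ :=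
  ∑ j ∈ Finset.range (w 2), clusterMin w G φ j (w 1)

/-- `φ` is a clustering of least cost. -/
def Optimal (φ : ℕ) : Prop :=
  Clustering w G φ ∧ ∀ φ' < G, Clustering w G φ' → clusterCost w G φ ≤ clusterCost w G φ'

/-- The first candidate of least rank sum in cluster `j` of `φ`. -/
noncomputable def leader (φ j : ℕ) : ℕ :=
  leastBelow (w 1) fun c => clusterSum w G φ j c ≤ clusterMin w G φ j (w 1)

/-- `c` leads some cluster of `φ`. -/
def IsLeader (φ c : ℕ) : Prop := ∃ j < w 2, leader w G φ j = c

/-- The rank of the best leader of `φ` in the vote `v`. -/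
noncomputable def leaderRank (φ v : ℕ) : ℕ := leastBelow (w 1) fun i => IsLeader w G φ (cand w v i)

/-- The sum of the ranks of `c` in the votes of cluster `j` of `ψ` that are marked by `u`. -/
noncomputable def markedSum (ψ u j c : ℕ) : ℕ :=
  ∑ v ∈ Finset.range (w 0), ind (digit w G ψ v = j ∧ digit w G u v = 1) * rk w v c

/-- The candidate `c ≠ s` may represent the cluster `j` of `ψ` with the excess given by `t`: its rank
sum is within the excess, and it is no leader of `φ` and below the leaders in the marked votes. -/
def Allowed (φ s ψ u t j c : ℕ) : Prop :=
  c ≠ s ∧ clusterSum w G ψ j c ≤ clusterMin w G ψ j s + digit w G t j ∧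
    ∀ v < w 0, digit w G ψ v = j ∧ digit w G u v = 1 →
      ¬ IsLeader w G φ c ∧ leaderRank w G φ v < rk w v c

/-- The least marked rank sum of a candidate that may represent the cluster `j`. -/
noncomputable def markedMin (φ s ψ u t j : ℕ) : ℕ :=
  leastBelow G fun x => ∃ c < w 1, Allowed w G φ s ψ u t j c ∧ markedSum w G ψ u j c ≤ x

/-- The guessed data describe representatives that overtake the leaders of `φ` within `w 3`
swaps. -/
def Overtakes (φ s ψ u t : ℕ) : Prop :=
  (∀ j < w 2, ∃ c < w 1, Allowed w G φ s ψ u t j c) ∧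
  ∑ j ∈ Finset.range (w 2), markedMin w G φ s ψ u t j ≤
    w 3 + ∑ v ∈ Finset.range (w 0), ind (digit w G u v = 1) * leaderRank w G φ v ∧
  ∑ j ∈ Finset.range (w 2), (clusterMin w G ψ j s + digit w G t j) ≤
    w 3 + ∑ v ∈ Finset.range (w 0), ind (digit w G u v = 1) +
      ∑ v ∈ Finset.range (w 0), leaderRank w G φ v

/-- The leaders of `φ` can be overtaken by a different committee. -/
def Overtaken (φ : ℕ) : Prop :=
  ∃ j < w 2, ∃ ψ < G, Clustering w G ψ ∧
    ∃ u < G, ∃ t < G, Overtakes w G φ (leader w G φ j) ψ u t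

/-- The number of votes with the candidate `c` on top. -/
noncomputable def topCount (c : ℕ) : ℕ := ∑ v ∈ Finset.range (w 0), ind (cand w v 0 = c)

/-- The number of candidates that are on top of some vote. -/
noncomputable def numTops : ℕ := ∑ c ∈ Finset.range (w 1), ind (topCount w c ≠ 0)

/-- The set of top candidates can be changed by `w 3` swaps. -/
def TopsChange : Prop := ∃ c < w 1,
  (topCount w c = 0 ∧ ∃ v < w 0, rk w v c ≤ w 3) ∨ (topCount w c ≠ 0 ∧ topCount w c ≤ w 3)

/-- The outcome of the algorithm. -/
def Answer : Prop :=
  (0 < w 0 ∧ 0 < w 2) ∧ (w 2 < w 1 ∧ 0 < w 3) ∧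
    ((numTops w < w 2 ∧ TopsChange w) ∨
      (w 2 ≤ numTops w ∧ ∃ φ < G, Optimal w G φ ∧ Overtaken w G φ))

end Formula

/-! ### The algorithm as a term -/

namespace Tm

def nT : Tm := .inp (.const 0)
def mT : Tm := .inp (.const 1)
def kT : Tm := .inp (.const 2)
def swT : Tm := .inp (.const 3)

/-- `quo` of the variable `10`. -/
def quoT : Tm :=
  muT 11 12 .bound (ltT (.var 10) (.sum 13 (.add nT (.const 1)) (.add (.var 11) (.const 1))))

/-- `digit` of the variables `14` and `15`. -/
def digitT : Tm :=
  letT 10 (.iter 10 (.var 15) (.var 14) quoT)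
    (.sub (.var 10) (.sum 16 (.add nT (.const 1)) quoT))

def callDigit (g v : ℕ) : Tm := letT 14 (.var g) (letT 15 (.var v) digitT)

/-- `cand` of the variables `20` and `21`. -/
def candT : Tm := .inp (.add (.add (.const 4) (.sum 22 mT (.var 20))) (.var 21))

def callCand (v i : ℕ) : Tm := letT 20 (.var v) (letT 21 (.var i) candT)

/-- `rk` of the variables `24` and `25`. -/
def rkT : Tm := muT 26 27 mT (eqT (callCand 24 26) (.var 25))

def callRk (v c : ℕ) : Tm := letT 24 (.var v) (letT 25 (.var c) rkT)

/-- `clusterSum` of the variables `30`, `31` and `32`. -/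
def clusterSumT : Tm :=
  .sum 33 nT (ifT (eqT (callDigit 30 33) (.var 31)) (callRk 33 32))

def callClusterSum (p j c : ℕ) : Tm :=
  letT 30 (.var p) (letT 31 (.var j) (letT 32 (.var c) clusterSumT))

/-- `clusterMin` of the variables `35`, `36` and `37`. -/
def clusterMinT : Tm :=
  muT 38 39 .bound (exT 40 mT (andT (notT (eqT (.var 40) (.var 37)))
    (leT (callClusterSum 35 36 40) (.var 38))))

def callClusterMin (p j : ℕ) (s : Tm) : Tm :=
  letT 35 (.var p) (letT 36 (.var j) (letT 37 s clusterMinT))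

/-- `Clustering` of the variable `p`. -/
def clusteringT (p : ℕ) : Tm := allT 43 nT (ltT (callDigit p 43) kT)

/-- `clusterCost` of the variable `p`. -/
def clusterCostT (p : ℕ) : Tm := .sum 44 kT (callClusterMin p 44 mT)

/-- `Optimal` of the variable `46`. -/
def optimalT : Tm :=
  andT (clusteringT 46) (allT 47 .bound (orT (notT (clusteringT 47))
    (leT (clusterCostT 46) (clusterCostT 47))))

/-- `leader` of the variables `50` and `51`. -/
def leaderT : Tm := muT 52 53 mT (leT (callClusterSum 50 51 52) (callClusterMin 50 51 mT))

def callLeader (p j : ℕ) : Tm := letT 50 (.var p) (letT 51 (.var j) leaderT)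

/-- `IsLeader` of the variables `55` and `56`. -/
def isLeaderT : Tm := exT 57 kT (eqT (callLeader 55 57) (.var 56))

def callIsLeader (p : ℕ) (c : Tm) : Tm := letT 55 (.var p) (letT 56 c isLeaderT)

/-- `leaderRank` of the variables `60` and `61`. -/
def leaderRankT : Tm := muT 62 63 mT (callIsLeader 60 (callCand 61 62))

def callLeaderRank (p v : ℕ) : Tm := letT 60 (.var p) (letT 61 (.var v) leaderRankT)

/-- `markedSum` of the variables `72`, `73`, `75` and `76`. -/
def markedSumT : Tm :=
  .sum 77 nT (ifT (andT (eqT (callDigit 72 77) (.var 75)) (eqT (callDigit 73 77) (.const 1)))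
    (callRk 77 76))

/-- `Allowed` of the variables `70` to `76`. -/
def allowedT : Tm :=
  andT (notT (eqT (.var 76) (.var 71)))
    (andT (leT (callClusterSum 72 75 76) (.add (callClusterMin 72 75 (.var 71)) (callDigit 74 75)))
      (allT 78 nT (orT (notT (andT (eqT (callDigit 72 78) (.var 75))
          (eqT (callDigit 73 78) (.const 1))))
        (andT (notT (callIsLeader 70 (.var 76))) (ltT (callLeaderRank 70 78) (callRk 78 76))))))

/-- `markedMin` of the variables `70` to `75`. -/
def markedMinT : Tm :=
  muT 79 80 .bound (exT 76 mT (andT allowedT (leT markedSumT (.var 79))))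

/-- `Overtakes` of the variables `70` to `74`. -/
def overtakesT : Tm :=
  andT (allT 75 kT (exT 76 mT allowedT))
    (andT
      (leT (.sum 75 kT markedMinT)
        (.add swT (.sum 81 nT (ifT (eqT (callDigit 73 81) (.const 1)) (callLeaderRank 70 81)))))
      (leT (.sum 75 kT (.add (callClusterMin 72 75 (.var 71)) (callDigit 74 75)))
        (.add (.add swT (.sum 81 nT (eqT (callDigit 73 81) (.const 1))))
          (.sum 81 nT (callLeaderRank 70 81)))))

/-- `Overtaken` of the variable `70`. -/
def overtakenT : Tm :=
  exT 82 kT (exT 72 .bound (andT (clusteringT 72) (exT 73 .bound (exT 74 .bound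
    (letT 71 (callLeader 70 82) overtakesT)))))

/-- `topCount` of the variable `90`. -/
def topCountT : Tm :=
  .sum 91 nT (eqT (letT 92 (.const 0) (callCand 91 92)) (.var 90))

def numTopsT : Tm := .sum 90 mT (notT (notT topCountT))

def topsChangeT : Tm :=
  exT 90 mT (orT (andT (notT topCountT) (exT 93 nT (leT (callRk 93 90) swT)))
    (andT topCountT (leT topCountT swT)))

def answerT : Tm :=
  andT (andT (ltT (.const 0) nT) (ltT (.const 0) kT))
    (andT (andT (ltT kT mT) (ltT (.const 0) swT))
      (orT (andT (ltT numTopsT kT) topsChangeT)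
        (andT (leT kT numTopsT)
          (exT 46 .bound (andT optimalT (letT 70 (.var 46) overtakenT))))))

/-! ### The terms compute the formula. -/

variable {w : ℕ → ℕ} {G : ℕ} {e : ℕ → ℕ}

theorem eval_quoT (hn : w 0 + 1 ≤ G) : quoT.eval w G e = quo w G (e 10) := by
  simp [quoT, quo, leastBelow, eval_muT, eval_ltT, eval, nT, hn, ind_eq_zero]

/-- Arguments are passed by successive assignments, so the second must not be read from the name
that the first overwrites. The inequalities of names in the lemmas below likewise exclude clashes
with parameters or bound variables. -/
theorem eval_callDigit (hn : w 0 + 1 ≤ G) (g v : ℕ) (hv : v ≠ 14) :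
    (callDigit g v).eval w G e = digit w G (e g) (e v) := by
  have hG : 1 ≤ G := by omega
  simp [callDigit, digitT, digit, eval_letT hG, eval, eval_quoT hn, nT, hn, hv]

theorem eval_callCand (hm : w 1 ≤ G) (hG : 1 ≤ G) (v i : ℕ) (hi : i ≠ 20) :
    (callCand v i).eval w G e = cand w (e v) (e i) := by
  simp [callCand, candT, cand, eval_letT hG, eval, mT, hm, hi]

theorem eval_callRk (hm : w 1 ≤ G) (hG : 1 ≤ G) (v c : ℕ) (hc : c ≠ 24) :
    (callRk v c).eval w G e = rk w (e v) (e c) := by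
  simp [callRk, rkT, rk, leastBelow, eval_letT hG, eval_muT, eval_eqT, eval_callCand hm hG, eval, mT,
    hm, hc, ind_eq_zero]

/-- The bound `G` exceeds the ranges of all loops over voters and candidates. -/
structure Big (w : ℕ → ℕ) (G : ℕ) : Prop where
  n_lt : w 0 + 1 ≤ G
  m_le : w 1 ≤ G
  k_le : w 2 ≤ G

theorem Big.one_le (h : Big w G) : 1 ≤ G := by have := h.n_lt; omega

theorem Big.n_le (h : Big w G) : w 0 ≤ G := by have := h.n_lt; omega

theorem eval_callClusterSum (h : Big w G) (p j c : ℕ) (hj : j ≠ 30) (hc : c ≠ 30) (hc' : c ≠ 31) :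
    (callClusterSum p j c).eval w G e = clusterSum w G (e p) (e j) (e c) := by
  simp [callClusterSum, clusterSumT, clusterSum, eval_letT h.one_le, eval, nT, h.n_le,
    eval_ifT h.one_le, eval_eqT, eval_callDigit h.n_lt, eval_callRk h.m_le h.one_le, hj, hc, hc',
    ind_eq_zero]

theorem eval_callClusterMin (h : Big w G) (p j : ℕ) (s : Tm) (hj : j ≠ 35) :
    (callClusterMin p j s).eval w G e = clusterMin w G (e p) (e j)
      (s.eval w G (update (update e 35 (e p)) 36 (e j))) := by
  simp [callClusterMin, clusterMinT, clusterMin, leastBelow, eval_letT h.one_le, eval, mT, h.m_le,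
    eval_muT, eval_exT, eval_andT, eval_notT, eval_leT, eval_eqT, eval_callClusterSum h, hj,
    ind_eq_zero]

theorem eval_clusteringT (h : Big w G) (p : ℕ) (hp : p ≠ 43) :
    (clusteringT p).eval w G e = ind (Clustering w G (e p)) := by
  simp [clusteringT, Clustering, eval, nT, kT, h.n_le, eval_allT, eval_ltT,
    eval_callDigit h.n_lt, hp, ind_eq_zero]

theorem eval_clusterCostT (h : Big w G) (p : ℕ) (hp : p ≠ 44) :
    (clusterCostT p).eval w G e = clusterCost w G (e p) := by
  simp [clusterCostT, clusterCost, eval, mT, kT, h.k_le, eval_callClusterMin h, hp]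

theorem eval_optimalT (h : Big w G) : optimalT.eval w G e = ind (Optimal w G (e 46)) := by
  simp [optimalT, Optimal, eval, eval_andT, eval_orT, eval_allT, eval_notT, eval_leT,
    eval_clusteringT h, eval_clusterCostT h, ind_eq_zero, imp_iff_not_or]

theorem eval_callLeader (h : Big w G) (p j : ℕ) (hj : j ≠ 50) :
    (callLeader p j).eval w G e = leader w G (e p) (e j) := by
  simp [callLeader, leaderT, leader, leastBelow, eval_letT h.one_le, eval, mT, h.m_le,
    eval_muT, eval_leT, eval_callClusterSum h, eval_callClusterMin h, hj, ind_eq_zero]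

theorem eval_callIsLeader (h : Big w G) (p : ℕ) (c : Tm) :
    (callIsLeader p c).eval w G e =
      ind (IsLeader w G (e p) (c.eval w G (update e 55 (e p)))) := by
  simp [callIsLeader, isLeaderT, IsLeader, eval_letT h.one_le, eval, kT, h.k_le, eval_exT,
    eval_eqT, eval_callLeader h, ind_eq_zero]

theorem eval_callLeaderRank (h : Big w G) (p v : ℕ) (hv : v ≠ 60) :
    (callLeaderRank p v).eval w G e = leaderRank w G (e p) (e v) := by
  simp [callLeaderRank, leaderRankT, leaderRank, leastBelow, eval_letT h.one_le, eval, mT, h.m_le,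
    eval_muT, eval_callIsLeader h, eval_callCand h.m_le h.one_le, hv, ind_eq_zero]

theorem eval_markedSumT (h : Big w G) :
    markedSumT.eval w G e = markedSum w G (e 72) (e 73) (e 75) (e 76) := by
  simp [markedSumT, markedSum, eval, nT, h.n_le, eval_ifT h.one_le, eval_eqT, eval_andT,
    eval_callDigit h.n_lt, eval_callRk h.m_le h.one_le, ind_eq_zero]

theorem eval_allowedT (h : Big w G) : allowedT.eval w G e =
    ind (Allowed w G (e 70) (e 71) (e 72) (e 73) (e 74) (e 75) (e 76)) := by
  simp [allowedT, Allowed, eval, nT, h.n_le, eval_eqT, eval_andT, eval_orT, eval_notT, eval_leT,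
    eval_ltT, eval_allT, eval_callDigit h.n_lt, eval_callRk h.m_le h.one_le,
    eval_callClusterSum h, eval_callClusterMin h, eval_callIsLeader h, eval_callLeaderRank h,
    ind_eq_zero, imp_iff_not_or, or_assoc]

theorem eval_markedMinT (h : Big w G) : markedMinT.eval w G e =
    markedMin w G (e 70) (e 71) (e 72) (e 73) (e 74) (e 75) := by
  simp [markedMinT, markedMin, leastBelow, eval, mT, h.m_le, eval_muT, eval_exT, eval_andT,
    eval_leT, eval_allowedT h, eval_markedSumT h, ind_eq_zero]

theorem eval_overtakesT (h : Big w G) : overtakesT.eval w G e =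
    ind (Overtakes w G (e 70) (e 71) (e 72) (e 73) (e 74)) := by
  simp [overtakesT, Overtakes, eval, mT, nT, kT, swT, h.m_le, h.n_le, h.k_le, eval_exT, eval_allT,
    eval_andT, eval_leT, eval_eqT, eval_ifT h.one_le, eval_allowedT h, eval_markedMinT h,
    eval_callDigit h.n_lt, eval_callClusterMin h, eval_callLeaderRank h, ind_eq_zero]

theorem eval_overtakenT (h : Big w G) : overtakenT.eval w G e = ind (Overtaken w G (e 70)) := by
  simp [overtakenT, Overtaken, eval, kT, h.k_le, eval_exT, eval_andT, eval_letT h.one_le,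
    eval_clusteringT h, eval_callLeader h, eval_overtakesT h, ind_eq_zero]

theorem eval_topCountT (h : Big w G) : topCountT.eval w G e = topCount w (e 90) := by
  simp [topCountT, topCount, eval, nT, h.n_le, eval_eqT, eval_letT h.one_le,
    eval_callCand h.m_le h.one_le]

theorem eval_numTopsT (h : Big w G) : numTopsT.eval w G e = numTops w := by
  simp [numTopsT, numTops, eval, mT, h.m_le, eval_notT, eval_topCountT h, ind_eq_zero]

theorem eval_topsChangeT (h : Big w G) : topsChangeT.eval w G e = ind (TopsChange w) := by
  simp [topsChangeT, TopsChange, eval, mT, nT, swT, h.m_le, h.n_le, eval_notT, eval_orT, eval_andT,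
    eval_exT, eval_leT, eval_callRk h.m_le h.one_le, eval_topCountT h, ind_eq_zero,
    or_iff_not_imp_left]

/-- Without voters the number of candidates may be huge compared with the length of the list, so `w
1 ≤ G` is available only for `0 < w 0`. The leading conjuncts of `Answer` decide that case, and they
also give `w 2 ≤ G` through `w 2 < w 1`. -/
theorem eval_answerT (hn : w 0 + 1 ≤ G) (hm : 0 < w 0 → w 1 ≤ G) :
    answerT.eval w G e = ind (Answer w G) := by
  simp only [answerT, Answer, eval, mT, nT, kT, swT, eval_andT, eval_orT, eval_ltT, eval_leT,
    ne_eq, ind_eq_zero, not_not]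
  congr 1
  refine propext (and_congr_right fun h0 => and_congr_right fun h1 => ?_)
  have hm := hm h0.1
  have h : Big w G := ⟨hn, hm, by omega⟩
  simp [eval, eval_exT, eval_andT, eval_letT h.one_le, eval_numTopsT h, eval_topsChangeT h,
    eval_optimalT h, eval_overtakenT h, ind_eq_zero]

end Tm
end RobustCC

namespace RobustCC

open Finset

/-! ### Adjacent swaps in a single vote -/

section Vote

variable {m : ℕ}

/-- The number of candidates above `c` in the vote `σ`. -/
def rank (σ : Equiv.Perm (Fin m)) (c : Fin m) : ℕ := (σ.symm c : ℕ)

theorem rank_inj {σ : Equiv.Perm (Fin m)} {c d : Fin m} (h : rank σ c = rank σ d) : c = d :=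
  σ.symm.injective (Fin.ext h)

theorem exists_rank_eq (σ : Equiv.Perm (Fin m)) {r : ℕ} (hr : r < m) : ∃ c, rank σ c = r :=
  ⟨σ ⟨r, hr⟩, by simp [rank]⟩

theorem rank_lt (σ : Equiv.Perm (Fin m)) (c : Fin m) : rank σ c < m := (σ.symm c).2

/-- The rank of the best member of a committee in a vote. -/
noncomputable def bestRank (σ : Equiv.Perm (Fin m)) (S : Finset (Fin m)) : ℕ :=
  sInf {r | ∃ c ∈ S, rank σ c = r}

theorem bestRank_le {σ : Equiv.Perm (Fin m)} {S : Finset (Fin m)} {c : Fin m} (hc : c ∈ S) :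
    bestRank σ S ≤ rank σ c := Nat.sInf_le ⟨c, hc, rfl⟩

theorem exists_rank_eq_bestRank (σ : Equiv.Perm (Fin m)) {S : Finset (Fin m)} (hS : S.Nonempty) :
    ∃ c ∈ S, rank σ c = bestRank σ S := by
  obtain ⟨c, hc⟩ := hS
  exact Nat.sInf_mem (s := {r | ∃ c ∈ S, rank σ c = r}) ⟨_, c, hc, rfl⟩

theorem le_bestRank {σ : Equiv.Perm (Fin m)} {S : Finset (Fin m)} (hS : S.Nonempty) {x : ℕ}
    (h : ∀ c ∈ S, x ≤ rank σ c) : x ≤ bestRank σ S := by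
  obtain ⟨c, hc, e⟩ := exists_rank_eq_bestRank σ hS
  exact e ▸ h c hc

/-- `VoteReach b σ τ`: the vote `τ` is obtained from `σ` by exactly `b` adjacent swaps. -/
inductive VoteReach : ℕ → Equiv.Perm (Fin m) → Equiv.Perm (Fin m) → Prop
  | refl (σ : Equiv.Perm (Fin m)) : VoteReach 0 σ σ
  | step {b : ℕ} {σ τ : Equiv.Perm (Fin m)} (i j : Fin m) (hij : (j : ℕ) = (i : ℕ) + 1) :
      VoteReach b σ τ → VoteReach (b + 1) σ ((Equiv.swap i j).trans τ)

theorem VoteReach.trans {a b : ℕ} {σ τ ρ : Equiv.Perm (Fin m)} (h : VoteReach a σ τ)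
    (h' : VoteReach b τ ρ) : VoteReach (a + b) σ ρ := by
  induction h' with
  | refl => exact h
  | step i j hij _ ih => exact VoteReach.step i j hij (ih h)

theorem rank_swap (σ : Equiv.Perm (Fin m)) {i j : Fin m} (hij : (j : ℕ) = (i : ℕ) + 1)
    (c : Fin m) : rank ((Equiv.swap i j).trans σ) c =
      if rank σ c = i then (i : ℕ) + 1 else if rank σ c = i + 1 then (i : ℕ) else rank σ c := by
  simp only [rank, Equiv.symm_trans_apply, Equiv.symm_swap, Equiv.swap_apply_def, ← hij,
    Fin.val_inj]
  split_ifs <;> simp [hij]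

/-- The swap that raises the candidate of rank `r + 1`. -/
theorem exists_raise (σ : Equiv.Perm (Fin m)) {t : Fin m} {r : ℕ} (ht : rank σ t = r + 1) :
    ∃ τ, VoteReach 1 σ τ ∧ rank τ t = r ∧ ∀ c ≠ t, rank σ c ≤ rank τ c := by
  have hlt := rank_lt σ t
  have hij : ((⟨r + 1, by omega⟩ : Fin m) : ℕ) = ((⟨r, by omega⟩ : Fin m) : ℕ) + 1 := rfl
  refine ⟨_, VoteReach.step _ _ hij (VoteReach.refl σ), ?_, fun c hc => ?_⟩
  · rw [rank_swap σ hij, ht]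
    simp
  · have : rank σ c ≠ r + 1 := fun h => hc (rank_inj (h.trans ht.symm))
    rw [rank_swap σ hij]
    split_ifs with h1
    · exact h1.trans_le (Nat.le_succ _)
    · exact le_rfl

/-- Raising a candidate to the rank `r`. -/
theorem exists_raise_to (σ : Equiv.Perm (Fin m)) (t : Fin m) (r d : ℕ) (ht : rank σ t = r + d) :
    ∃ τ, VoteReach d σ τ ∧ rank τ t = r ∧ ∀ c ≠ t, r ≤ rank σ c → r < rank τ c := by
  induction d generalizing σ with
  | zero =>
    refine ⟨σ, .refl σ, ht, fun c hc h => lt_of_le_of_ne h fun h' => hc ?_⟩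
    exact rank_inj (by omega : rank σ c = rank σ t)
  | succ d ih =>
    obtain ⟨τ, h1, h2, h3⟩ := exists_raise σ (t := t) (r := r + d) ht
    obtain ⟨ρ, g1, g2, g3⟩ := ih τ h2
    refine ⟨ρ, (by omega : 1 + d = d + 1) ▸ h1.trans g1, g2, fun c hc h => ?_⟩
    exact g3 c hc (h.trans (h3 c hc))

theorem VoteReach.rank_le {b : ℕ} {σ τ : Equiv.Perm (Fin m)} (h : VoteReach b σ τ) (c : Fin m) :
    rank σ c ≤ rank τ c + b := by
  induction h with
  | refl => simp
  | @step b σ τ i j hij _ ih =>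
    rw [rank_swap τ hij]
    split_ifs <;> omega

/-- The effect of one swap on the best rank of a committee and on the rank of a candidate. -/
theorem bestRank_swap (σ : Equiv.Perm (Fin m)) {i j : Fin m} (hij : (j : ℕ) = (i : ℕ) + 1)
    {S : Finset (Fin m)} (hS : S.Nonempty) (t : Fin m) :
    bestRank ((Equiv.swap i j).trans σ) S + rank σ t ≤
      bestRank σ S + rank ((Equiv.swap i j).trans σ) t + 1 ∨
    (t ∉ S ∧ rank σ t = bestRank σ S + 1 ∧
      bestRank ((Equiv.swap i j).trans σ) S = rank ((Equiv.swap i j).trans σ) t + 1) := by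
  obtain ⟨c, hc, e⟩ := exists_rank_eq_bestRank σ hS
  have h1 : bestRank ((Equiv.swap i j).trans σ) S ≤ rank ((Equiv.swap i j).trans σ) c :=
    bestRank_le hc
  have h2 := rank_swap σ hij c
  have h3 := rank_swap σ hij t
  by_cases ht : t ∈ S
  · left
    have h4 : bestRank ((Equiv.swap i j).trans σ) S ≤ rank ((Equiv.swap i j).trans σ) t :=
      bestRank_le ht
    have h5 : bestRank σ S ≤ rank σ t := bestRank_le ht
    split_ifs at h2 h3 <;> omega
  · by_cases h6 : bestRank ((Equiv.swap i j).trans σ) S + rank σ t ≤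
      bestRank σ S + rank ((Equiv.swap i j).trans σ) t + 1
    · exact Or.inl h6
    · right
      -- A gain of two means that `t` rises and `c` sinks in the same swap, so these two exchange
      -- adjacent places.
      refine ⟨ht, ?_⟩
      split_ifs at h2 h3 <;> omega

/-- The bound on the gain of a candidate on a committee by `b` swaps: one more than `b` only if the
candidate overtakes the committee. -/
theorem VoteReach.gain_le {b : ℕ} {σ τ : Equiv.Perm (Fin m)} (h : VoteReach b σ τ)
    {S : Finset (Fin m)} (hS : S.Nonempty) (t : Fin m) :
    bestRank τ S + rank σ t ≤ bestRank σ S + rank τ t + b ∨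
    (t ∉ S ∧ bestRank σ S < rank σ t ∧ rank τ t < bestRank τ S ∧ rank σ t ≤ bestRank σ S + b ∧
      bestRank τ S + rank σ t ≤ bestRank σ S + rank τ t + b + 1) := by
  induction h with
  | refl => exact Or.inl (by omega)
  | @step b σ τ i j hij _ ih =>
    have hne : t ∉ S → rank τ t ≠ bestRank τ S := by
      intro ht h
      obtain ⟨c, hc, e⟩ := exists_rank_eq_bestRank τ hS
      exact ht (rank_inj (h.trans e.symm) ▸ hc)
    have hne' : t ∉ S → rank ((Equiv.swap i j).trans τ) t ≠
        bestRank ((Equiv.swap i j).trans τ) S := by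
      intro ht h
      obtain ⟨c, hc, e⟩ := exists_rank_eq_bestRank ((Equiv.swap i j).trans τ) hS
      exact ht (rank_inj (h.trans e.symm) ▸ hc)
    by_cases ht : t ∈ S
    · rcases bestRank_swap τ hij hS t with h1 | h1
      · rcases ih with ih | ih
        · exact Or.inl (by omega)
        · exact absurd ht ih.1
      · exact absurd ht h1.1
    -- The extra gain cannot be collected twice: it needs `t` directly below `S`, while in the
    -- second alternative `t` is above `S`. If `t` started above `S` or falls behind `S` again, the
    -- first alternative holds.
    · have := hne ht
      have := hne' ht
      simp only [ht, not_false_eq_true, true_and] at ih ⊢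
      rcases bestRank_swap τ hij hS t with h1 | ⟨-, h1⟩ <;> rcases ih with ih | ih <;> omega

end Vote

/-! ### Adjacent swaps in an election -/

section Elect

variable {m n : ℕ}

theorem SwapReach.mono {B B' : ℕ} {E E' : Election m n} (h : SwapReach B E E') (hB : B ≤ B') :
    SwapReach B' E E' := by
  induction h generalizing B' with
  | refl => exact .refl _ _
  | step _ hs ih =>
    obtain ⟨B'', rfl⟩ : ∃ B'', B' = B'' + 1 := ⟨B' - 1, by omega⟩
    exact .step (ih (by omega)) hs

theorem SwapReach.trans {B B' : ℕ} {E E' E'' : Election m n} (h : SwapReach B E E')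
    (h' : SwapReach B' E' E'') : SwapReach (B + B') E E'' := by
  induction h' with
  | refl => exact h.mono (Nat.le_add_right _ _)
  | step _ hs ih => exact .step (ih h) hs

theorem VoteReach.swapReach {b : ℕ} {τ : Equiv.Perm (Fin m)} {E : Election m n} {v : Fin n}
    {σ : Equiv.Perm (Fin m)} (h : VoteReach b σ τ) (hv : E v = σ) :
    SwapReach b E (Function.update E v τ) := by
  induction h with
  | refl => rw [← hv, Function.update_eq_self]; exact .refl _ _
  | step i j hij _ ih =>
    refine .step (ih hv) ⟨v, i, j, hij, ?_⟩
    rw [Function.update_self, Function.update_idem]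

theorem swapReach_of_votes {E E' : Election m n} {b : Fin n → ℕ}
    (h : ∀ v, VoteReach (b v) (E v) (E' v)) : SwapReach (∑ v, b v) E E' := by
  have key : ∀ s : Finset (Fin n), SwapReach (∑ v ∈ s, b v) E (s.piecewise E' E) := by
    intro s
    induction s using Finset.induction_on with
    | empty => simpa using SwapReach.refl 0 E
    | insert v s hv ih =>
      rw [Finset.sum_insert hv, add_comm, Finset.piecewise_insert]
      exact ih.trans ((h v).swapReach (Finset.piecewise_eq_of_notMem _ _ _ hv))
  simpa using key univ

theorem SwapReach.exists_votes {B : ℕ} {E E' : Election m n} (h : SwapReach B E E') :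
    ∃ b : Fin n → ℕ, ∑ v, b v ≤ B ∧ ∀ v, VoteReach (b v) (E v) (E' v) := by
  induction h with
  | refl B E => exact ⟨0, by simp, fun v => .refl _⟩
  | step _ hs ih =>
    obtain ⟨b, hb, hr⟩ := ih
    obtain ⟨v, i, j, hij, rfl⟩ := hs
    refine ⟨b + Pi.single v 1, ?_, fun u => ?_⟩
    · simp only [Pi.add_apply, Finset.sum_add_distrib]
      simpa using hb
    · by_cases hu : u = v
      · subst hu
        simpa using VoteReach.step i j hij (hr u)
      · simpa [hu] using hr u

/-! ### Scores and winning committees in terms of ranks -/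

/-- The sum of the best ranks of a committee. -/
noncomputable def rankCost (E : Election m n) (S : Finset (Fin m)) : ℕ := ∑ v, bestRank (E v) S

theorem voteScore_add_bestRank (E : Election m n) (v : Fin n) {S : Finset (Fin m)}
    (hS : S.Nonempty) : voteScore E v S + bestRank (E v) S = m - 1 := by
  obtain ⟨c, hc, e⟩ := exists_rank_eq_bestRank (E v) hS
  have hlt := rank_lt (E v) c
  have : voteScore E v S = m - 1 - bestRank (E v) S := by
    refine le_antisymm (Finset.sup_le fun d hd => ?_) ?_
    · have := bestRank_le (σ := E v) hd
      simp only [borda, pos]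
      simp only [rank] at this
      omega
    · refine le_trans (le_of_eq ?_) (Finset.le_sup (f := fun c => borda m (pos E v c)) hc)
      simp only [borda, pos]
      rw [← e]
      simp only [rank]
      omega
  omega

/-- Each voter contributes `m - 1` minus the best rank; so maximizing the score is minimizing the
rank cost. -/
theorem ccScore_add_rankCost (E : Election m n) {S : Finset (Fin m)} (hS : S.Nonempty) :
    ccScore E S + rankCost E S = n * (m - 1) := by
  rw [ccScore, rankCost, ← Finset.sum_add_distrib,
    Finset.sum_congr rfl fun v _ => voteScore_add_bestRank E v hS]
  simp

theorem mem_betaCC_iff {E : Election m n} {k : ℕ} (hk : 0 < k) {S : Finset (Fin m)} :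
    S ∈ betaCC m n E k ↔ S.card = k ∧ ∀ T : Finset (Fin m), T.card = k →
      rankCost E S ≤ rankCost E T := by
  refine and_congr_right fun hS => forall_congr' fun T => forall_congr' fun hT => ?_
  have h1 := ccScore_add_rankCost E (S := S) (Finset.card_pos.1 (by omega))
  have h2 := ccScore_add_rankCost E (S := T) (Finset.card_pos.1 (by omega))
  omega

theorem exists_mem_betaCC (E : Election m n) {k : ℕ} (hkm : k ≤ m) :
    ∃ S, S ∈ betaCC m n E k := by
  obtain ⟨S, hS, h⟩ := Finset.exists_max_image (powersetCard k (univ : Finset (Fin m)))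
    (ccScore E) (Finset.powersetCard_nonempty.2 (by simpa using hkm))
  refine ⟨S, (Finset.mem_powersetCard.1 hS).2, fun T hT => h T ?_⟩
  exact Finset.mem_powersetCard.2 ⟨Finset.subset_univ _, hT⟩

/-! ### Top candidates and winning committees. -/

/-- The candidates on top of some vote. -/
noncomputable def tops (E : Election m n) : Finset (Fin m) :=
  univ.filter fun c => ∃ v, rank (E v) c = 0

theorem mem_tops {E : Election m n} {c : Fin m} : c ∈ tops E ↔ ∃ v, rank (E v) c = 0 := by
  simp [tops]

theorem bestRank_eq_zero {σ : Equiv.Perm (Fin m)} {S : Finset (Fin m)} (hS : S.Nonempty)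
    {c : Fin m} (hc : rank σ c = 0) : bestRank σ S = 0 ↔ c ∈ S := by
  constructor
  · intro h
    obtain ⟨d, hd, e⟩ := exists_rank_eq_bestRank σ hS
    exact rank_inj (hc.trans (h.symm.trans e.symm)) ▸ hd
  · intro h
    have := bestRank_le (σ := σ) h
    omega

/-- A small committee that is as good as all larger ones contains all top candidates. -/
theorem tops_subset_of_optimal {E : Election m n} {k : ℕ} (hkm : k ≤ m) {Q : Finset (Fin m)}
    (hQ : Q.Nonempty) (hQk : Q.card < k)
    (hopt : ∀ T : Finset (Fin m), T.card = k → rankCost E Q ≤ rankCost E T) : tops E ⊆ Q := by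
  intro x hx
  obtain ⟨v, hv⟩ := mem_tops.1 hx
  by_contra hxQ
  -- Adding a missing top candidate `x` and padding to size `k` would strictly lower the cost in the
  -- vote led by `x`.
  obtain ⟨T, hT, hTk⟩ := Finset.exists_superset_card_eq (s := insert x Q) (n := k)
    ((Finset.card_insert_le _ _).trans hQk) (by simpa using hkm)
  have hxT : x ∈ T := hT (Finset.mem_insert_self _ _)
  have hQT : Q ⊆ T := (Finset.subset_insert _ _).trans hT
  refine absurd (hopt T hTk) (not_le.2 (Finset.sum_lt_sum
    (fun u _ => le_bestRank hQ fun c hc => bestRank_le (hQT hc)) ⟨v, mem_univ _, ?_⟩))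
  rw [(bestRank_eq_zero ⟨x, hxT⟩ hv).2 hxT]
  exact Nat.pos_of_ne_zero fun h => hxQ ((bestRank_eq_zero hQ hv).1 h)

/-- A committee has rank cost `0` exactly if it contains all tops, and with at most `k` tops this
value is attained. -/
theorem mem_betaCC_iff_tops_subset {E : Election m n} {k : ℕ} (hk : 0 < k) (hkm : k ≤ m)
    (ht : (tops E).card ≤ k) {S : Finset (Fin m)} :
    S ∈ betaCC m n E k ↔ S.card = k ∧ tops E ⊆ S := by
  have hm : 0 < m := by omega
  have key : ∀ T : Finset (Fin m), T.card = k → (rankCost E T = 0 ↔ tops E ⊆ T) := by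
    intro T hT
    have hT' : T.Nonempty := Finset.card_pos.1 (by omega)
    rw [rankCost, Finset.sum_eq_zero_iff]
    constructor
    · intro h c hc
      obtain ⟨v, hv⟩ := mem_tops.1 hc
      exact (bestRank_eq_zero hT' hv).1 (h v (mem_univ _))
    · intro h v _
      obtain ⟨c, hc⟩ := exists_rank_eq (E v) hm
      exact (bestRank_eq_zero hT' hc).2 (h (mem_tops.2 ⟨v, hc⟩))
  rw [mem_betaCC_iff hk]
  refine and_congr_right fun hS => ?_
  rw [← key S hS]
  constructor
  · intro h
    obtain ⟨T, hT, hTk⟩ := Finset.exists_superset_card_eq ht (by simpa using hkm)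
    have := h T hTk
    rw [(key T hTk).2 hT] at this
    omega
  · intro h T _
    omega

/-! ### Few top candidates -/

theorem exists_card_eq_avoiding {k : ℕ} (hkm : k < m) {A : Finset (Fin m)} (hA : A.card ≤ k)
    {c : Fin m} (hc : c ∉ A) : ∃ S : Finset (Fin m), S.card = k ∧ A ⊆ S ∧ c ∉ S := by
  obtain ⟨S, h1, h2, h3⟩ := Finset.exists_subsuperset_card_eq (s := A) (t := univ.erase c)
    (n := k) (fun x hx => Finset.mem_erase.2 ⟨fun h => hc (h ▸ hx), mem_univ _⟩) hA
    (by rw [Finset.card_erase_of_mem (mem_univ _), Finset.card_univ, Fintype.card_fin]; omega)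
  exact ⟨S, h3, h1, fun h => Finset.notMem_erase _ _ (h2 h)⟩

/-- Lifting `c` adds no other top, so at most `k` tops remain. A winner containing the old tops but
not `c` loses. -/
theorem exists_change_of_new_top {E : Election m n} {k B : ℕ} (hk : 0 < k) (hkm : k < m)
    (ht : (tops E).card < k) {c : Fin m} {v : Fin n} (hc : c ∉ tops E) (hr : rank (E v) c ≤ B) :
    ∃ E', SwapReach B E E' ∧ betaCC m n E' k ≠ betaCC m n E k := by
  obtain ⟨τ, h1, h2, -⟩ := exists_raise_to (E v) c 0 (rank (E v) c) (by simp)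
  refine ⟨_, (h1.swapReach rfl).mono hr, fun hE => ?_⟩
  have hsub : tops (Function.update E v τ) ⊆ insert c (tops E) := by
    intro d hd
    obtain ⟨u, hu⟩ := mem_tops.1 hd
    by_cases huv : u = v
    · subst huv
      rw [Function.update_self] at hu
      rw [rank_inj (hu.trans h2.symm)]
      exact Finset.mem_insert_self _ _
    · rw [Function.update_of_ne huv] at hu
      exact Finset.mem_insert_of_mem (mem_tops.2 ⟨u, hu⟩)
  have hcard : (tops (Function.update E v τ)).card ≤ k :=
    (Finset.card_le_card hsub).trans ((Finset.card_insert_le _ _).trans ht)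
  obtain ⟨S, hS, hA, hcS⟩ := exists_card_eq_avoiding hkm ht.le hc
  have hmem := (mem_betaCC_iff_tops_subset hk hkm.le ht.le).2 ⟨hS, hA⟩
  rw [← hE, mem_betaCC_iff_tops_subset hk hkm.le hcard] at hmem
  exact hcS (hmem.2 (mem_tops.2 ⟨v, by rw [Function.update_self, h2]⟩))

/-- In every vote led by `a`, swap `a` with the runner-up. If some runner-up is not a top, a single
swap already creates a new top. Otherwise no top is added and `a` is lost, so a committee without
`a` becomes winning. -/
theorem exists_change_of_lost_top {E : Election m n} {k B : ℕ} (hk : 0 < k) (hkm : k < m)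
    (ht : (tops E).card < k) {a : Fin m} (ha : a ∈ tops E)
    (hr : (univ.filter fun v => rank (E v) a = 0).card ≤ B) :
    ∃ E', SwapReach B E E' ∧ betaCC m n E' k ≠ betaCC m n E k := by
  by_cases hnew : ∃ v c, rank (E v) a = 0 ∧ rank (E v) c = 1 ∧ c ∉ tops E
  · obtain ⟨v, c, hva, hvc, hc⟩ := hnew
    refine exists_change_of_new_top hk hkm ht hc (v := v) ?_
    rw [hvc]
    exact le_trans (Finset.card_pos.2 ⟨v, by simp [hva]⟩) hr
  push Not at hnew
  have hex : ∀ v, ∃ τ, VoteReach (if rank (E v) a = 0 then 1 else 0) (E v) τ ∧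
      rank τ a ≠ 0 ∧ ∀ c, rank τ c = 0 → c ∈ tops E := by
    intro v
    by_cases hva : rank (E v) a = 0
    · rw [if_pos hva]
      obtain ⟨c, hc⟩ := exists_rank_eq (E v) (r := 1) (by omega)
      obtain ⟨τ, h1, h2, h3⟩ := exists_raise (E v) (t := c) (r := 0) hc
      have hca : a ≠ c := by rintro rfl; omega
      refine ⟨τ, h1, fun h => hca (rank_inj (h.trans h2.symm)), fun d hd => ?_⟩
      rw [rank_inj (hd.trans h2.symm)]
      exact hnew v c hva hc
    · rw [if_neg hva]
      exact ⟨E v, .refl _, hva, fun c hc => mem_tops.2 ⟨v, hc⟩⟩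
  choose E' h1 h2 h3 using hex
  refine ⟨E', (swapReach_of_votes h1).mono (by simpa using hr), fun hE => ?_⟩
  have hsub : tops E' ⊆ tops E := by
    intro d hd
    obtain ⟨u, hu⟩ := mem_tops.1 hd
    exact h3 u d hu
  have hcard : (tops E').card ≤ k := (Finset.card_le_card hsub).trans ht.le
  obtain ⟨S, hS, hA, hcS⟩ := exists_card_eq_avoiding hkm hcard (c := a) (by
    rw [mem_tops]
    rintro ⟨v, hv⟩
    exact h2 v hv)
  have hmem := (mem_betaCC_iff_tops_subset hk hkm.le hcard).2 ⟨hS, hA⟩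
  rw [hE, mem_betaCC_iff_tops_subset hk hkm.le ht.le] at hmem
  exact hcS (hmem.2 ha)

/-- With fewer than `k` top candidates, the outcome changes as soon as the set of top candidates
does. -/
theorem change_iff_of_few_tops {E : Election m n} {k B : ℕ} (hk : 0 < k) (hkm : k < m)
    (ht : (tops E).card < k) :
    (∃ E', SwapReach B E E' ∧ betaCC m n E' k ≠ betaCC m n E k) ↔
      ∃ c, (c ∉ tops E ∧ ∃ v, rank (E v) c ≤ B) ∨
        (c ∈ tops E ∧ (univ.filter fun v => rank (E v) c = 0).card ≤ B) := by
  constructor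
  · rintro ⟨E', hr, hne⟩
    obtain ⟨b, hb, hv⟩ := hr.exists_votes
    have htne : tops E' ≠ tops E := by
      intro h
      refine hne (Set.ext fun S => ?_)
      rw [mem_betaCC_iff_tops_subset hk hkm.le (h ▸ ht.le),
        mem_betaCC_iff_tops_subset hk hkm.le ht.le, h]
    have hbv : ∀ v, b v ≤ B := fun v =>
      (Finset.single_le_sum (fun _ _ => Nat.zero_le _) (mem_univ v)).trans hb
    by_cases hsub : tops E' ⊆ tops E
    · obtain ⟨a, ha, ha'⟩ := Finset.exists_of_ssubset (hsub.ssubset_of_ne htne)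
      refine ⟨a, Or.inr ⟨ha, ?_⟩⟩
      rw [Finset.card_filter]
      refine le_trans (Finset.sum_le_sum fun v _ => ?_) hb
      split_ifs with h0
      -- With no swap in a vote led by `a`, it would still lead that vote in `E'`.
      · by_contra hlt
        have h0' : b v = 0 := by omega
        have := hv v
        rw [h0'] at this
        have hEq : E' v = E v := by
          generalize hx : E' v = x at this
          cases this
          rfl
        exact ha' (mem_tops.2 ⟨v, by rw [hEq, h0]⟩)
      · exact Nat.zero_le _
    · obtain ⟨c, hc, hc'⟩ := Finset.not_subset.1 hsub
      obtain ⟨v, h0⟩ := mem_tops.1 hc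
      refine ⟨c, Or.inl ⟨hc', v, ?_⟩⟩
      have := (hv v).rank_le c
      have := hbv v
      omega
  · rintro ⟨c, ⟨hc, v, hv⟩ | ⟨hc, hv⟩⟩
    · exact exists_change_of_new_top hk hkm ht hc hv
    · exact exists_change_of_lost_top hk hkm ht hc hv

end Elect
end RobustCC

namespace RobustCC

open Finset

/-! ### Many top candidates -/

section Many

variable {m n : ℕ}

/-- Representatives that can be made at least as good as the committee `S` by `B` swaps: `t v` is
the representative of voter `v`, and `U` is the set of the voters where it overtakes `S`. -/
structure Overtaking (E : Election m n) (k B : ℕ) (S : Finset (Fin m)) (t : Fin n → Fin m)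
    (U : Finset (Fin n)) (s : Fin m) : Prop where
  mem : s ∈ S
  card_le : (univ.image t).card ≤ k
  ne : ∀ v, t v ≠ s
  below : ∀ v ∈ U, t v ∉ S ∧ bestRank (E v) S < rank (E v) (t v)
  marked_le : ∑ v ∈ U, rank (E v) (t v) ≤ B + ∑ v ∈ U, bestRank (E v) S
  total_le : ∑ v, rank (E v) (t v) ≤ B + U.card + ∑ v, bestRank (E v) S

theorem rankCost_le_of_rep (E : Election m n) {T : Finset (Fin m)} {t : Fin n → Fin m}
    (ht : ∀ v, t v ∈ T) : rankCost E T ≤ ∑ v, rank (E v) (t v) :=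
  Finset.sum_le_sum fun v _ => bestRank_le (ht v)

theorem exists_rep (E : Election m n) {T : Finset (Fin m)} (hT : T.Nonempty) :
    ∃ t : Fin n → Fin m, ∀ v, t v ∈ T ∧ rank (E v) (t v) = bestRank (E v) T := by
  choose t ht using fun v => exists_rank_eq_bestRank (E v) hT
  exact ⟨t, ht⟩

/-- A second winner of `E` yields the data at once, with `U` empty. Otherwise `S` is the only winner
of `E`, some `T ≠ S` wins in `E'`, and summing `VoteReach.gain_le` over the voters bounds the
deficit of the representatives of `T`. -/
theorem exists_overtaking_of_betaCC_ne {E E' : Election m n} {k B : ℕ} (hk : 0 < k) (hkm : k < m)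
    {S : Finset (Fin m)} (hS : S ∈ betaCC m n E k) (hr : SwapReach B E E')
    (hne : betaCC m n E' k ≠ betaCC m n E k) : ∃ t U s, Overtaking E k B S t U s := by
  have hSk := ((mem_betaCC_iff hk).1 hS).1
  have hS0 : S.Nonempty := Finset.card_pos.1 (by omega)
  have hdiff : ∀ T : Finset (Fin m), T.card = k → T ≠ S → ∃ s ∈ S, s ∉ T := by
    intro T hT hTS
    by_contra! h
    exact hTS (Finset.eq_of_subset_of_card_le h (by omega)).symm
  have himage : ∀ (T : Finset (Fin m)) (t : Fin n → Fin m), T.card = k → (∀ v, t v ∈ T) →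
      (univ.image t).card ≤ k := by
    intro T t hT ht
    rw [← hT]
    exact Finset.card_le_card (Finset.image_subset_iff.2 fun v _ => ht v)
  by_cases htie : ∃ T ∈ betaCC m n E k, T ≠ S
  · obtain ⟨T, hT, hTS⟩ := htie
    have hTk := ((mem_betaCC_iff hk).1 hT).1
    obtain ⟨s, hs, hsT⟩ := hdiff T hTk hTS
    obtain ⟨t, ht⟩ := exists_rep E (T := T) (Finset.card_pos.1 (by omega))
    refine ⟨t, ∅, s, hs, himage T t hTk fun v => (ht v).1, fun v h => hsT (h ▸ (ht v).1), by simp,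
      by simp, ?_⟩
    have h1 : ∑ v, rank (E v) (t v) = rankCost E T := Finset.sum_congr rfl fun v _ => (ht v).2
    have h2 := ((mem_betaCC_iff hk).1 hT).2 S hSk
    have h3 : rankCost E S = ∑ v, bestRank (E v) S := rfl
    omega
  · push Not at htie
    obtain ⟨T, hT, hTS⟩ : ∃ T ∈ betaCC m n E' k, T ≠ S := by
      by_contra! h
      refine hne (Set.ext fun T => ⟨fun hT => h T hT ▸ hS, fun hT => ?_⟩)
      obtain ⟨T', hT'⟩ := exists_mem_betaCC E' hkm.le
      rw [htie T hT, ← h T' hT']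
      exact hT'
    have hTk := ((mem_betaCC_iff hk).1 hT).1
    obtain ⟨s, hs, hsT⟩ := hdiff T hTk hTS
    obtain ⟨t, ht⟩ := exists_rep E' (T := T) (Finset.card_pos.1 (by omega))
    obtain ⟨b, hb, hv⟩ := hr.exists_votes
    classical
    -- The voters for whom the extra gain of one is possible; the last condition makes the
    -- overtakings affordable.
    let U : Finset (Fin n) := univ.filter fun v => t v ∉ S ∧ bestRank (E v) S < rank (E v) (t v) ∧
      rank (E v) (t v) ≤ bestRank (E v) S + b v
    refine ⟨t, U, s, hs, himage T t hTk fun v => (ht v).1, fun v h => hsT (h ▸ (ht v).1),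
      fun v hv => ⟨(Finset.mem_filter.1 hv).2.1, (Finset.mem_filter.1 hv).2.2.1⟩, ?_, ?_⟩
    · have h1 : ∑ v ∈ U, rank (E v) (t v) ≤ ∑ v ∈ U, (bestRank (E v) S + b v) :=
        Finset.sum_le_sum fun v hv => (Finset.mem_filter.1 hv).2.2.2
      have h2 : ∑ v ∈ U, b v ≤ ∑ v, b v :=
        Finset.sum_le_sum_of_subset (Finset.subset_univ _)
      rw [Finset.sum_add_distrib] at h1
      omega
    · have h1 : ∑ v, (bestRank (E' v) S + rank (E v) (t v)) ≤
          ∑ v, (bestRank (E v) S + rank (E' v) (t v) + b v + if v ∈ U then 1 else 0) := by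
        refine Finset.sum_le_sum fun v _ => ?_
        rcases (hv v).gain_le hS0 (t v) with h | ⟨h1, h2, -, h3, h4⟩
        · omega
        · have : v ∈ U := Finset.mem_filter.2 ⟨mem_univ _, h1, h2, h3⟩
          rw [if_pos this]
          omega
      have h2 : ∑ v, rank (E' v) (t v) = rankCost E' T :=
        Finset.sum_congr rfl fun v _ => (ht v).2
      have h3 := ((mem_betaCC_iff hk).1 hT).2 S hSk
      have h4 : rankCost E' S = ∑ v, bestRank (E' v) S := rfl
      have h5 : (∑ v, if v ∈ U then 1 else 0) = U.card := by simp
      simp only [Finset.sum_add_distrib] at h1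
      omega

/-- Raising representatives that are below the committee removes a deficit of `d` by `d` swaps. -/
theorem exists_raise_reps {S : Finset (Fin m)} (hS : S.Nonempty) (t : Fin n → Fin m) (d : ℕ) :
    ∀ E : Election m n, ∑ v, rank (E v) (t v) ≤ ∑ v, bestRank (E v) S + d →
    ∃ E', SwapReach d E E' ∧ ∑ v, rank (E' v) (t v) ≤ ∑ v, bestRank (E' v) S := by
  induction d with
  | zero => exact fun E h => ⟨E, .refl _ _, h⟩
  | succ d ih =>
    intro E h
    by_cases hle : ∑ v, rank (E v) (t v) ≤ ∑ v, bestRank (E v) S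
    · exact ⟨E, .refl _ _, hle⟩
    obtain ⟨v, -, hv⟩ := Finset.exists_lt_of_sum_lt (not_le.1 hle)
    obtain ⟨r, hr⟩ : ∃ r, rank (E v) (t v) = r + 1 := ⟨rank (E v) (t v) - 1, by omega⟩
    obtain ⟨τ, h1, h2, h3⟩ := exists_raise (E v) hr
    -- Even if `t v` belongs to `S`, it was strictly below the best member, so one step up does not
    -- improve the best rank.
    have hbest : bestRank (E v) S ≤ bestRank τ S := by
      refine le_bestRank hS fun c hc => ?_
      by_cases hct : c = t v
      · subst hct
        omega
      · exact (bestRank_le hc).trans (h3 c hct)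
    obtain ⟨E', g1, g2⟩ := ih (Function.update E v τ) (by
      have e1 : ∑ u, rank (Function.update E v τ u) (t u) + 1 ≤ ∑ u, rank (E u) (t u) := by
        refine Nat.succ_le_of_lt (Finset.sum_lt_sum (fun u _ => ?_) ⟨v, mem_univ _, ?_⟩)
        · by_cases hu : u = v
          · subst hu
            rw [Function.update_self]
            omega
          · rw [Function.update_of_ne hu]
        · rw [Function.update_self]
          omega
      have e2 : ∑ u, bestRank (E u) S ≤ ∑ u, bestRank (Function.update E v τ u) S := by
        refine Finset.sum_le_sum fun u _ => ?_
        by_cases hu : u = v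
        · subst hu
          rwa [Function.update_self]
        · rw [Function.update_of_ne hu]
      omega)
    exact ⟨E', by simpa [add_comm] using (h1.swapReach rfl).trans g1, g2⟩

/-- If the best member of `T` in some vote is not in `S` and not on top, then one swap breaks the
tie of `S` and `T`. -/
theorem exists_swap_of_rep {E : Election m n} {k : ℕ} (hk : 0 < k) {S T : Finset (Fin m)}
    (hS : S ∈ betaCC m n E k) (hT : T ∈ betaCC m n E k) {v : Fin n} {c : Fin m} (hcT : c ∈ T)
    (hc : rank (E v) c = bestRank (E v) T) (hc0 : rank (E v) c ≠ 0)
    (h : c ∉ S ∨ bestRank (E v) S = 0) :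
    ∃ E', SwapReach 1 E E' ∧ betaCC m n E' k ≠ betaCC m n E k := by
  have hS' := (mem_betaCC_iff hk).1 hS
  have hT' := (mem_betaCC_iff hk).1 hT
  obtain ⟨r, hr⟩ : ∃ r, rank (E v) c = r + 1 := ⟨rank (E v) c - 1, by omega⟩
  obtain ⟨τ, h1, h2, h3⟩ := exists_raise (E v) hr
  refine ⟨_, h1.swapReach rfl, fun hE => ?_⟩
  rw [← hE, mem_betaCC_iff hk] at hS
  have e0 := hS.2 T hT'.1
  -- Raising `c` makes `T` strictly cheaper and `S` no cheaper, so `S` loses the tie.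
  have e1 : rankCost (Function.update E v τ) T < rankCost E T := by
    refine Finset.sum_lt_sum (fun u _ => ?_) ⟨v, mem_univ _, ?_⟩
    · by_cases hu : u = v
      · subst hu
        rw [Function.update_self, ← hc]
        exact (bestRank_le hcT).trans (by omega)
      · rw [Function.update_of_ne hu]
    · rw [Function.update_self, ← hc]
      exact (bestRank_le hcT).trans_lt (by omega)
  have e2 : rankCost E S ≤ rankCost (Function.update E v τ) S := by
    refine Finset.sum_le_sum fun u _ => ?_
    by_cases hu : u = v
    · subst hu
      rw [Function.update_self]
      rcases h with h | h
      · refine le_bestRank (Finset.card_pos.1 (by omega)) fun d hd => ?_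
        exact (bestRank_le hd).trans (h3 d fun h' => h (h' ▸ hd))
      · rw [h]
        exact Nat.zero_le _
    · rw [Function.update_of_ne hu]
  have := hT'.2 S hS'.1
  have := hS'.2 T hT'.1
  omega

/-- With at least `k` top candidates, a tie can be broken by one swap. -/
theorem exists_swap_of_tie {E : Election m n} {k : ℕ} (hk : 0 < k) (hkm : k < m)
    (ht : k ≤ (tops E).card) {S T : Finset (Fin m)} (hS : S ∈ betaCC m n E k)
    (hT : T ∈ betaCC m n E k) (hne : T ≠ S) :
    ∃ E', SwapReach 1 E E' ∧ betaCC m n E' k ≠ betaCC m n E k := by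
  have hS' := (mem_betaCC_iff hk).1 hS
  have hT' := (mem_betaCC_iff hk).1 hT
  have hS0 : S.Nonempty := Finset.card_pos.1 (by omega)
  have hT0 : T.Nonempty := Finset.card_pos.1 (by omega)
  obtain ⟨t, htr⟩ := exists_rep E hT0
  obtain ⟨s, hsr⟩ := exists_rep E hS0
  by_cases hall : ∀ v, t v ∈ S
  -- Otherwise `T ∩ S`, with fewer than `k` members, would be as good as every committee of size `k`
  -- and so contain all tops, of which there are at least `k`.
  · exfalso
    have hQ : ∀ v, t v ∈ T ∩ S := fun v => Finset.mem_inter.2 ⟨(htr v).1, hall v⟩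
    obtain ⟨c, hc⟩ : (tops E).Nonempty := Finset.card_pos.1 (by omega)
    obtain ⟨v, -⟩ := mem_tops.1 hc
    have hlt : (T ∩ S).card < k := by
      rw [← hS'.1]
      refine Finset.card_lt_card (Finset.inter_subset_right.ssubset_of_ne fun h => hne ?_)
      exact (Finset.eq_of_subset_of_card_le (Finset.inter_eq_right.1 h) (by omega)).symm
    have hsub := tops_subset_of_optimal (E := E) hkm.le ⟨t v, hQ v⟩ hlt fun R hR => by
      have h1 := rankCost_le_of_rep E hQ
      have h2 : ∑ v, rank (E v) (t v) = rankCost E T := Finset.sum_congr rfl fun v _ => (htr v).2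
      have h3 := hT'.2 R hR
      omega
    have := Finset.card_le_card hsub
    omega
  · push Not at hall
    obtain ⟨v, hv⟩ := hall
    -- If `t v` leads the vote, the best member of `S` does not; then `S` and `T` exchange their
    -- roles.
    by_cases h0 : rank (E v) (t v) = 0
    · have hs0 : rank (E v) (s v) ≠ 0 := fun h =>
        hv (rank_inj (h0.trans h.symm) ▸ (hsr v).1)
      exact exists_swap_of_rep hk hT hS (hsr v).1 (hsr v).2 hs0 (Or.inr ((htr v).2 ▸ h0))
    · exact exists_swap_of_rep hk hS hT (htr v).1 (htr v).2 h0 (Or.inl hv)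

/-- Extend the representatives to a committee `T` without `s`. Unless `T` is already tied with `S`,
first lift the representatives in `U` to the place of the best of `S`, and spend the remaining swaps
one by one on the deficit. Then `T` costs at most as much as `S`. -/
theorem exists_change_of_overtaking {E : Election m n} {k B : ℕ} (hk : 0 < k) (hkm : k < m)
    (hB : 0 < B) (ht : k ≤ (tops E).card) {S : Finset (Fin m)} (hS : S ∈ betaCC m n E k)
    {t : Fin n → Fin m} {U : Finset (Fin n)} {s : Fin m} (h : Overtaking E k B S t U s) :
    ∃ E', SwapReach B E E' ∧ betaCC m n E' k ≠ betaCC m n E k := by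
  have hS' := (mem_betaCC_iff hk).1 hS
  have hS0 : S.Nonempty := Finset.card_pos.1 (by omega)
  obtain ⟨T, hTk, hT, hsT⟩ := exists_card_eq_avoiding hkm h.card_le (c := s) (by
    simpa using h.ne)
  have htT : ∀ v, t v ∈ T := fun v => hT (Finset.mem_image_of_mem _ (mem_univ _))
  have hTS : T ≠ S := fun e => hsT (e ▸ h.mem)
  by_cases hTw : T ∈ betaCC m n E k
  · obtain ⟨E', h1, h2⟩ := exists_swap_of_tie hk hkm ht hS hTw hTS
    exact ⟨E', h1.mono hB, h2⟩
  have hex : ∀ v, ∃ τ, VoteReach (if v ∈ U then rank (E v) (t v) - bestRank (E v) S else 0)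
      (E v) τ ∧ if v ∈ U then rank τ (t v) = bestRank (E v) S ∧
        bestRank (E v) S + 1 ≤ bestRank τ S else τ = E v := by
    intro v
    by_cases hv : v ∈ U
    · simp only [if_pos hv]
      obtain ⟨h1, h2⟩ := h.below v hv
      obtain ⟨τ, g1, g2, g3⟩ := exists_raise_to (E v) (t v) (bestRank (E v) S)
        (rank (E v) (t v) - bestRank (E v) S) (by omega)
      exact ⟨τ, g1, g2, le_bestRank hS0 fun c hc =>
        g3 c (fun e => h1 (e ▸ hc)) (bestRank_le hc)⟩
    · simp only [if_neg hv]
      exact ⟨E v, .refl _, rfl⟩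
  choose E₁ h1 h2 using hex
  have hreach := swapReach_of_votes h1
  set b := ∑ v, if v ∈ U then rank (E v) (t v) - bestRank (E v) S else 0 with hb
  have hb' : b + ∑ v ∈ U, bestRank (E v) S = ∑ v ∈ U, rank (E v) (t v) := by
    rw [hb, Finset.sum_ite_mem, Finset.univ_inter, ← Finset.sum_add_distrib]
    exact Finset.sum_congr rfl fun v hv => Nat.sub_add_cancel (h.below v hv).2.le
  have hbB : b ≤ B := by
    have := h.marked_le
    omega
  -- Each overtaking pushes the best of `S` down by one place; this is the bonus `|U|` in
  -- `total_le`.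
  have hdef : ∑ v, rank (E₁ v) (t v) ≤ ∑ v, bestRank (E₁ v) S + (B - b) := by
    have key : ∑ v, (rank (E₁ v) (t v) + bestRank (E v) S + (if v ∈ U then 1 else 0) +
        (if v ∈ U then rank (E v) (t v) - bestRank (E v) S else 0)) ≤
        ∑ v, (bestRank (E₁ v) S + rank (E v) (t v)) := by
      refine Finset.sum_le_sum fun v _ => ?_
      have := h2 v
      by_cases hv : v ∈ U
      · have hlt := (h.below v hv).2
        simp only [if_pos hv] at this ⊢
        omega
      · simp only [if_neg hv] at this ⊢
        rw [this]
        omega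
    have h5 : (∑ v, if v ∈ U then 1 else 0) = U.card := by simp
    have := h.total_le
    simp only [Finset.sum_add_distrib] at key
    omega
  obtain ⟨E', g1, g2⟩ := exists_raise_reps hS0 t (B - b) E₁ hdef
  -- With an unchanged outcome `S` would win in `E'`, hence so would `T`, which does not win in `E`.
  refine ⟨E', (hreach.trans g1).mono (by omega), fun hE => ?_⟩
  have hS'' := hS
  rw [← hE, mem_betaCC_iff hk] at hS''
  rw [← hE] at hTw
  refine hTw ((mem_betaCC_iff hk).2 ⟨hTk, fun R hR => ?_⟩)
  have e1 := rankCost_le_of_rep E' htT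
  have e2 := hS''.2 R hR
  have e3 : rankCost E' S = ∑ v, bestRank (E' v) S := rfl
  omega

/-- With at least `k` top candidates, the outcome changes if and only if some representatives can
overtake a fixed winning committee. -/
theorem change_iff_of_many_tops {E : Election m n} {k B : ℕ} (hk : 0 < k) (hkm : k < m)
    (hB : 0 < B) (ht : k ≤ (tops E).card) {S : Finset (Fin m)} (hS : S ∈ betaCC m n E k) :
    (∃ E', SwapReach B E E' ∧ betaCC m n E' k ≠ betaCC m n E k) ↔
      ∃ t U s, Overtaking E k B S t U s := by
  constructor
  · rintro ⟨E', h1, h2⟩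
    exact exists_overtaking_of_betaCC_ne hk hkm hS h1 h2
  · rintro ⟨t, U, s, h⟩
    exact exists_change_of_overtaking hk hkm hB ht hS h

end Many
end RobustCC

namespace RobustCC

open Finset

/-! ### The arithmetic of the formula -/

theorem leastBelow_eq {N : ℕ} {P : ℕ → Prop} {r : ℕ} (hr : r < N) (hP : P r)
    (hmin : ∀ q < r, ¬ P q) : leastBelow N P = r := by
  have h : ∀ x ∈ range N, ind (∀ q < x + 1, ¬ P q) = if x < r then 1 else 0 := by
    intro x _
    split_ifs with hx
    · exact ind_of fun q hq => hmin q (by omega)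
    · exact ind_of_not fun h => h r (by omega) hP
  rw [leastBelow, Finset.sum_congr rfl h, ← Finset.card_filter]
  have : (range N).filter (· < r) = range r := by
    ext x
    simp only [mem_filter, mem_range]
    omega
  rw [this, card_range]

theorem leastBelow_spec {N : ℕ} {P : ℕ → Prop} (h : ∃ r < N, P r) :
    leastBelow N P < N ∧ P (leastBelow N P) ∧ ∀ q, P q → leastBelow N P ≤ q := by
  classical
  obtain ⟨r, hr, hP⟩ := h
  have hex : ∃ r, P r := ⟨r, hP⟩
  have hlt : Nat.find hex < N := (Nat.find_min' hex hP).trans_lt hr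
  rw [leastBelow_eq hlt (Nat.find_spec hex) fun q hq => Nat.find_min hex hq]
  exact ⟨hlt, Nat.find_spec hex, fun q hq => Nat.find_min' hex hq⟩

/-- The minimum of a function as a bounded search for a value. -/
theorem leastBelow_min {N M : ℕ} {P : ℕ → Prop} {f : ℕ → ℕ} (hP : ∃ c < M, P c)
    (hf : ∀ c, f c < N) :
    (∃ c < M, P c ∧ f c = leastBelow N fun x => ∃ c < M, P c ∧ f c ≤ x) ∧
    ∀ c < M, P c → (leastBelow N fun x => ∃ c < M, P c ∧ f c ≤ x) ≤ f c := by
  obtain ⟨c₀, hc₀, hP₀⟩ := hP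
  obtain ⟨-, ⟨c, hc, hPc, hle⟩, h⟩ := leastBelow_spec (N := N)
    (P := fun x => ∃ c < M, P c ∧ f c ≤ x) ⟨f c₀, hf c₀, c₀, hc₀, hP₀, le_rfl⟩
  exact ⟨⟨c, hc, hPc, le_antisymm hle (h _ ⟨c, hc, hPc, le_rfl⟩)⟩,
    fun c hc hPc => h _ ⟨c, hc, hPc, le_rfl⟩⟩

/-- Turns sums over clusters into sums over voters, each voter being counted in the own cluster
only. -/
theorem sum_fiber {k n : ℕ} {p : ℕ → ℕ} (hp : ∀ v < n, p v < k) (F : ℕ → ℕ → ℕ) :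
    ∑ j ∈ range k, ∑ v ∈ range n, ind (p v = j) * F j v = ∑ v ∈ range n, F (p v) v := by
  rw [Finset.sum_comm]
  refine Finset.sum_congr rfl fun v hv => ?_
  rw [Finset.sum_eq_single (p v)]
  · rw [ind_of rfl, one_mul]
  · intro j _ hj
    rw [ind_of_not (Ne.symm hj), zero_mul]
  · intro h
    exact absurd (mem_range.2 (hp v (mem_range.1 hv))) h

theorem ind_and (P Q : Prop) : ind (P ∧ Q) = ind P * ind Q := by
  by_cases hP : P <;> by_cases hQ : Q <;> simp [ind, hP, hQ]

theorem sum_ind_mul {n : ℕ} {P : ℕ → Prop} {U : Finset (Fin n)} (h : ∀ v : Fin n, P v ↔ v ∈ U)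
    (f : ℕ → ℕ) : ∑ v ∈ range n, ind (P v) * f v = ∑ v ∈ U, f v := by
  rw [Finset.sum_range, ← Finset.univ_inter U, ← Finset.sum_ite_mem]
  refine Finset.sum_congr rfl fun v _ => ?_
  split_ifs with hv
  · rw [ind_of ((h v).2 hv), one_mul]
  · rw [ind_of_not fun h' => hv ((h v).1 h'), zero_mul]

theorem sum_ind {n : ℕ} {P : ℕ → Prop} {U : Finset (Fin n)} (h : ∀ v : Fin n, P v ↔ v ∈ U) :
    ∑ v ∈ range n, ind (P v) = U.card := by
  simpa using sum_ind_mul h fun _ => 1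

section Digits

variable {w : ℕ → ℕ} {G : ℕ}

theorem quo_eq {y : ℕ} (hy : y < G) : quo w G y = y / (w 0 + 1) := by
  refine leastBelow_eq ((Nat.div_le_self _ _).trans_lt hy) (Nat.lt_mul_div_succ _ (by omega)) ?_
  intro q hq
  rw [not_lt]
  calc (w 0 + 1) * (q + 1) ≤ (w 0 + 1) * (y / (w 0 + 1)) := by gcongr; omega
    _ ≤ y := Nat.mul_div_le _ _

theorem digit_eq {g v : ℕ} (hg : g < G) (hv : v ≤ G) :
    digit w G g v = g / (w 0 + 1) ^ v % (w 0 + 1) := by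
  have key : ∀ v, (quo w G)^[v] g = g / (w 0 + 1) ^ v := by
    intro v
    induction v with
    | zero => simp
    | succ v ih =>
      rw [Function.iterate_succ_apply', ih, quo_eq ((Nat.div_le_self _ _).trans_lt hg),
        Nat.div_div_eq_div_mul, pow_succ]
  rw [digit, min_eq_left hv, key, quo_eq ((Nat.div_le_self _ _).trans_lt hg), Nat.mod_eq_sub]

/-- Makes the searches below `G` exhaustive: they meet every function on the voters with values at
most `n`. -/
theorem exists_digits (hG : (w 0 + 1) ^ w 0 ≤ G) (hn : w 0 ≤ G) (p : ℕ → ℕ)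
    (hp : ∀ v < w 0, p v ≤ w 0) : ∃ g < G, ∀ v < w 0, digit w G g v = p v := by
  let f : Fin (w 0) → Fin (w 0 + 1) := fun v => ⟨p v, Nat.lt_succ_of_le (hp v v.2)⟩
  have hlt : (finFunctionFinEquiv f : ℕ) < G := (finFunctionFinEquiv f).2.trans_le hG
  refine ⟨finFunctionFinEquiv f, hlt, fun v hv => ?_⟩
  rw [digit_eq hlt (by omega)]
  have := finFunctionFinEquiv_symm_apply_val (finFunctionFinEquiv f) ⟨v, hv⟩
  rw [Equiv.symm_apply_apply] at this
  exact this.symm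

end Digits

/-! ### The formula describes the change of the outcome -/

section Bridge

variable {w : ℕ → ℕ} {G : ℕ} {E : Election (w 1) (w 0)}

/-- `w` lists the votes of `E`. -/
def Lists (w : ℕ → ℕ) (E : Election (w 1) (w 0)) : Prop :=
  ∀ (v : Fin (w 0)) (i : Fin (w 1)), cand w v i = (E v i : ℕ)

theorem Lists.cand_rank (hE : Lists w E) (v : Fin (w 0)) (c : Fin (w 1)) :
    cand w v (rank (E v) c) = c := by
  have := hE v ((E v).symm c)
  rwa [Equiv.apply_symm_apply] at this

theorem Lists.rk_eq (hE : Lists w E) (v : Fin (w 0)) (c : Fin (w 1)) :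
    rk w v c = rank (E v) c := by
  refine leastBelow_eq (rank_lt _ _) (hE.cand_rank v c) fun q hq h => ?_
  have hq' : q < w 1 := hq.trans (rank_lt _ _)
  rw [hE v ⟨q, hq'⟩, Fin.val_inj] at h
  rw [← h, rank, Equiv.symm_apply_apply] at hq
  exact lt_irrefl _ hq

theorem rk_le (v c : ℕ) : rk w v c ≤ w 1 := by
  unfold rk leastBelow
  refine (Finset.sum_le_sum fun _ _ => ind_le_one _).trans ?_
  simp

theorem Lists.topCount_eq (hE : Lists w E) (hm : 0 < w 1) (c : Fin (w 1)) :
    topCount w c = (univ.filter fun v => rank (E v) c = 0).card := by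
  rw [topCount, Finset.sum_range, Finset.card_filter]
  refine Finset.sum_congr rfl fun v _ => ?_
  have h : cand w v 0 = c ↔ rank (E v) c = 0 := by
    rw [hE v ⟨0, hm⟩, Fin.val_inj, rank]
    constructor
    · rintro rfl
      simp
    · intro h
      rw [← Equiv.eq_symm_apply]
      exact Fin.ext h.symm
  simp only [ind, h]

theorem Lists.topCount_ne_zero (hE : Lists w E) (hm : 0 < w 1) (c : Fin (w 1)) :
    topCount w c ≠ 0 ↔ c ∈ tops E := by
  rw [hE.topCount_eq hm, mem_tops, Finset.card_ne_zero]
  constructor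
  · rintro ⟨v, hv⟩
    exact ⟨v, (mem_filter.1 hv).2⟩
  · rintro ⟨v, hv⟩
    exact ⟨v, mem_filter.2 ⟨mem_univ _, hv⟩⟩

theorem Lists.numTops_eq (hE : Lists w E) (hm : 0 < w 1) : numTops w = (tops E).card :=
  sum_ind fun c => hE.topCount_ne_zero hm c

theorem Lists.topsChange_iff (hE : Lists w E) (hm : 0 < w 1) : TopsChange w ↔
    ∃ c, (c ∉ tops E ∧ ∃ v, rank (E v) c ≤ w 3) ∨
      (c ∈ tops E ∧ (univ.filter fun v => rank (E v) c = 0).card ≤ w 3) := by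
  have h : ∀ c : Fin (w 1), (topCount w c = 0 ∧ ∃ v < w 0, rk w v c ≤ w 3) ∨
      (topCount w c ≠ 0 ∧ topCount w c ≤ w 3) ↔ (c ∉ tops E ∧ ∃ v, rank (E v) c ≤ w 3) ∨
      (c ∈ tops E ∧ (univ.filter fun v => rank (E v) c = 0).card ≤ w 3) := by
    intro c
    rw [← hE.topCount_ne_zero hm c, ← hE.topCount_eq hm c, not_not]
    refine or_congr_left (and_congr_right fun _ => ⟨?_, ?_⟩)
    · rintro ⟨v, hv, h⟩
      exact ⟨⟨v, hv⟩, (hE.rk_eq ⟨v, hv⟩ c) ▸ h⟩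
    · rintro ⟨v, h⟩
      exact ⟨v, v.2, (hE.rk_eq v c).symm ▸ h⟩
  constructor
  · rintro ⟨c, hc, h'⟩
    exact ⟨⟨c, hc⟩, (h ⟨c, hc⟩).1 h'⟩
  · rintro ⟨c, h'⟩
    exact ⟨c, c.2, (h c).2 h'⟩

theorem card_tops_le {m n : ℕ} (hm : 0 < m) (E : Election m n) : (tops E).card ≤ n := by
  have hsub : tops E ⊆ univ.image fun v => E v ⟨0, hm⟩ := by
    intro c hc
    obtain ⟨v, hv⟩ := mem_tops.1 hc
    refine mem_image.2 ⟨v, mem_univ _, ?_⟩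
    rw [← Equiv.eq_symm_apply]
    exact Fin.ext hv.symm
  refine (card_le_card hsub).trans (card_image_le.trans ?_)
  simp

/-! ### Clusterings and their leaders. -/

/-- The bound `G` exceeds all numbers that the formula searches for. -/
structure Large (w : ℕ → ℕ) (G : ℕ) : Prop where
  pow_le : (w 0 + 1) ^ w 0 ≤ G
  n_le : w 0 ≤ G
  mul_lt : w 0 * w 1 < G

theorem sum_ind_mul_rk_lt (hG : Large w G) (P : ℕ → Prop) (c : ℕ) :
    ∑ v ∈ range (w 0), ind (P v) * rk w v c < G := by
  refine lt_of_le_of_lt (Finset.sum_le_sum (g := fun _ => w 1) fun v _ => ?_)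
    (by simpa using hG.mul_lt)
  exact (Nat.mul_le_mul (ind_le_one _) (rk_le v c)).trans (by simp)

theorem clusterMin_spec (hG : Large w G) (φ j : ℕ) {s : ℕ} (hs : ∃ c < w 1, c ≠ s) :
    (∃ c < w 1, c ≠ s ∧ clusterSum w G φ j c = clusterMin w G φ j s) ∧
    ∀ c < w 1, c ≠ s → clusterMin w G φ j s ≤ clusterSum w G φ j c :=
  leastBelow_min hs fun c => sum_ind_mul_rk_lt hG _ c

/-- The value `w 1` is no candidate, so `clusterMin` with `s = w 1` excludes nobody. -/
theorem leader_spec (hG : Large w G) (hm : 0 < w 1) (φ j : ℕ) :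
    leader w G φ j < w 1 ∧ clusterSum w G φ j (leader w G φ j) = clusterMin w G φ j (w 1) := by
  obtain ⟨⟨c, hc, -, h⟩, hmin⟩ := clusterMin_spec hG φ j (s := w 1) ⟨0, hm, hm.ne⟩
  obtain ⟨h1, h2, -⟩ := leastBelow_spec (N := w 1)
    (P := fun c => clusterSum w G φ j c ≤ clusterMin w G φ j (w 1)) ⟨c, hc, h.le⟩
  exact ⟨h1, le_antisymm h2 (hmin _ h1 h1.ne)⟩

open Classical in
/-- The committee of the leaders of `φ`. -/
noncomputable def leaders (w : ℕ → ℕ) (G φ : ℕ) : Finset (Fin (w 1)) :=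
  univ.filter fun c => IsLeader w G φ c

theorem mem_leaders {φ : ℕ} {c : Fin (w 1)} : c ∈ leaders w G φ ↔ IsLeader w G φ c := by
  simp [leaders]

theorem card_leaders_le (φ : ℕ) : (leaders w G φ).card ≤ w 2 := by
  rw [← Finset.card_image_of_injective _ Fin.val_injective]
  refine (card_le_card (t := (range (w 2)).image (leader w G φ)) ?_).trans
    (card_image_le.trans (by simp))
  intro c hc
  obtain ⟨d, hd, rfl⟩ := mem_image.1 hc
  obtain ⟨j, hj, h⟩ := mem_leaders.1 hd
  exact mem_image.2 ⟨j, mem_range.2 hj, h⟩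

theorem Lists.leaderRank_eq (hE : Lists w E) {φ : ℕ} (hL : (leaders w G φ).Nonempty)
    (v : Fin (w 0)) : leaderRank w G φ v = bestRank (E v) (leaders w G φ) := by
  obtain ⟨c, hc, h⟩ := exists_rank_eq_bestRank (E v) hL
  rw [← h]
  refine leastBelow_eq (rank_lt _ _) ?_ fun q hq hl => ?_
  · rw [hE.cand_rank v c]
    exact mem_leaders.1 hc
  · have hq' : q < w 1 := hq.trans (rank_lt _ _)
    rw [hE v ⟨q, hq'⟩] at hl
    have := bestRank_le (σ := E v) (mem_leaders.2 hl)
    rw [rank, Equiv.symm_apply_apply] at this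
    simp only at this
    omega

theorem Lists.sum_rk (hE : Lists w E) {t : ℕ → ℕ} {t' : Fin (w 0) → Fin (w 1)}
    (ht : ∀ v : Fin (w 0), t v = t' v) :
    ∑ v ∈ range (w 0), rk w v (t v) = ∑ v, rank (E v) (t' v) := by
  rw [Finset.sum_range]
  exact Finset.sum_congr rfl fun v _ => by rw [ht, hE.rk_eq]

/-- Serve each voter by the leader of the own cluster; another leader may be even better, hence only
an inequality. -/
theorem Lists.rankCost_leaders_le (hE : Lists w E) (hG : Large w G) (hm : 0 < w 1) {φ : ℕ}
    (hφ : Clustering w G φ) : rankCost E (leaders w G φ) ≤ clusterCost w G φ := by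
  let t : Fin (w 0) → Fin (w 1) := fun v =>
    ⟨leader w G φ (digit w G φ v), (leader_spec hG hm φ _).1⟩
  have h1 := rankCost_le_of_rep E (T := leaders w G φ) (t := t) fun v =>
    mem_leaders.2 ⟨_, hφ v v.2, rfl⟩
  refine h1.trans (le_of_eq ?_)
  rw [← hE.sum_rk (t := fun v => leader w G φ (digit w G φ v)) fun v => rfl, clusterCost,
    ← sum_fiber hφ fun j v => rk w v (leader w G φ j)]
  exact Finset.sum_congr rfl fun j _ => (leader_spec hG hm φ j).2

/-- Representatives of at most `k` different kinds come from a clustering. -/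
theorem exists_clustering (hG : Large w G) (hkn : w 2 ≤ w 0)
    {t : Fin (w 0) → Fin (w 1)} (ht : (univ.image t).card ≤ w 2) {s : ℕ} (hs : ∃ c < w 1, c ≠ s)
    (hts : ∀ v, (t v : ℕ) ≠ s) :
    ∃ φ < G, Clustering w G φ ∧ ∃ c : ℕ → ℕ, (∀ j, c j < w 1 ∧ c j ≠ s) ∧
      ∀ v : Fin (w 0), c (digit w G φ v) = t v := by
  set A := univ.image t with hA
  have htA : ∀ v, t v ∈ A := fun v => mem_image_of_mem _ (mem_univ _)
  obtain ⟨c₀, hc₀, hcs⟩ := hs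
  -- Clusters are numbered by an enumeration of the candidates that occur as representatives. The
  -- clusters left over are empty; `c₀` serves them as a dummy different from `s`.
  let p : ℕ → ℕ := fun v => if hv : v < w 0 then A.equivFin ⟨t ⟨v, hv⟩, htA _⟩ else 0
  have hp : ∀ v : Fin (w 0), p v = A.equivFin ⟨t v, htA v⟩ := fun v => by simp [p]
  have hpk : ∀ v < w 0, p v < w 2 := fun v hv => by
    rw [hp ⟨v, hv⟩]
    exact (Fin.is_lt _).trans_le ht
  obtain ⟨φ, hφ, hd⟩ := exists_digits hG.pow_le hG.n_le p fun v hv => (hpk v hv).le.trans hkn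
  refine ⟨φ, hφ, fun v hv => by rw [hd v hv]; exact hpk v hv,
    fun j => if hj : j < A.card then ((A.equivFin.symm ⟨j, hj⟩ : A) : Fin (w 1)) else c₀, ?_, ?_⟩
  · intro j
    by_cases hj : j < A.card
    · simp only [dif_pos hj]
      refine ⟨Fin.is_lt _, ?_⟩
      obtain ⟨v, -, hv⟩ := mem_image.1 (A.equivFin.symm ⟨j, hj⟩).2
      rw [← hv]
      exact hts v
    · simp only [dif_neg hj]
      exact ⟨hc₀, hcs⟩
  · intro v
    simp only [hd v v.2, hp v, Fin.is_lt, dif_pos, Fin.eta, Equiv.symm_apply_apply]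

theorem Lists.exists_clusterCost_le (hE : Lists w E) (hG : Large w G) (hkn : w 2 ≤ w 0)
    (hk : 0 < w 2) (hm : 0 < w 1) {T : Finset (Fin (w 1))} (hT : T.card = w 2) :
    ∃ φ < G, Clustering w G φ ∧ clusterCost w G φ ≤ rankCost E T := by
  obtain ⟨t, ht⟩ := exists_rep E (T := T) (Finset.card_pos.1 (by omega))
  have hs : ∃ c < w 1, c ≠ w 1 := ⟨0, hm, hm.ne⟩
  obtain ⟨φ, hφ, hcl, c, hc, hct⟩ := exists_clustering hG hkn (t := t) (s := w 1) (by
    rw [← hT]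
    exact card_le_card (image_subset_iff.2 fun v _ => (ht v).1)) hs (fun v => (t v).2.ne)
  refine ⟨φ, hφ, hcl, ?_⟩
  calc clusterCost w G φ ≤ ∑ j ∈ range (w 2), clusterSum w G φ j (c j) :=
        Finset.sum_le_sum fun j _ => (clusterMin_spec hG φ j hs).2 _ (hc j).1 (hc j).2
    _ = ∑ v ∈ range (w 0), rk w v (c (digit w G φ v)) := sum_fiber hcl fun j v => rk w v (c j)
    _ = ∑ v, rank (E v) (t v) := hE.sum_rk hct
    _ = rankCost E T := Finset.sum_congr rfl fun v _ => (ht v).2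

/-- An optimal clustering costs no more than any committee of size `k`. The leaders are exactly `k`:
if fewer, they would contain all tops by `tops_subset_of_optimal`, and there are at least `k` of
these. -/
theorem Lists.leaders_mem_betaCC (hE : Lists w E) (hG : Large w G) (hk : 0 < w 2)
    (hkm : w 2 < w 1) (ht : w 2 ≤ (tops E).card) {φ : ℕ} (hφ : Optimal w G φ) :
    leaders w G φ ∈ betaCC (w 1) (w 0) E (w 2) := by
  have hm : 0 < w 1 := by omega
  have hkn := ht.trans (card_tops_le hm E)
  have hopt : ∀ T : Finset (Fin (w 1)), T.card = w 2 →
      rankCost E (leaders w G φ) ≤ rankCost E T := by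
    intro T hT
    obtain ⟨ψ, hψ, hcl, hle⟩ := hE.exists_clusterCost_le hG hkn hk hm hT
    exact (hE.rankCost_leaders_le hG hm hφ.1).trans ((hφ.2 ψ hψ hcl).trans hle)
  have hne : (leaders w G φ).Nonempty :=
    ⟨⟨leader w G φ 0, (leader_spec hG hm φ 0).1⟩, mem_leaders.2 ⟨0, hk, rfl⟩⟩
  refine (mem_betaCC_iff hk).2 ⟨le_antisymm (card_leaders_le φ) ?_, hopt⟩
  by_contra hlt
  have := card_le_card (tops_subset_of_optimal hkm.le hne (not_le.1 hlt) hopt)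
  omega

theorem Lists.exists_optimal (hE : Lists w E) (hG : Large w G) (hk : 0 < w 2)
    (hkm : w 2 < w 1) (ht : w 2 ≤ (tops E).card) : ∃ φ < G, Optimal w G φ := by
  classical
  have hm : 0 < w 1 := by omega
  obtain ⟨S, hS⟩ := exists_mem_betaCC E hkm.le
  obtain ⟨φ₀, h1, h2, -⟩ := hE.exists_clusterCost_le hG (ht.trans (card_tops_le hm E)) hk hm hS.1
  obtain ⟨φ, hφ, h⟩ := Finset.exists_min_image ((range G).filter (Clustering w G))
    (clusterCost w G) ⟨φ₀, mem_filter.2 ⟨mem_range.2 h1, h2⟩⟩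
  have hφ' := mem_filter.1 hφ
  exact ⟨φ, mem_range.1 hφ'.1, hφ'.2, fun ψ hψ hcl => h ψ (mem_filter.2 ⟨mem_range.2 hψ, hcl⟩)⟩

/-! ### The search for overtaking representatives. -/

theorem Lists.exists_overtaking (hE : Lists w E) (hG : Large w G) (hm : 0 < w 1) {φ : ℕ}
    (h : Overtaken w G φ) : ∃ t U s, Overtaking E (w 2) (w 3) (leaders w G φ) t U s := by
  classical
  obtain ⟨j₀, hj₀, ψ, -, hψ, u, -, x, -, hall, hmark, htot⟩ := h
  set s := leader w G φ j₀ with hs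
  have hmem : (⟨s, (leader_spec hG hm φ j₀).1⟩ : Fin (w 1)) ∈ leaders w G φ :=
    mem_leaders.2 ⟨j₀, hj₀, rfl⟩
  have hex : ∀ j, ∃ c : Fin (w 1), j < w 2 → Allowed w G φ s ψ u x j c ∧
      markedSum w G ψ u j c ≤ markedMin w G φ s ψ u x j := by
    intro j
    by_cases hj : j < w 2
    · obtain ⟨⟨c, hc, hal, hle⟩, -⟩ := leastBelow_min (N := G) (f := markedSum w G ψ u j)
        (hall j hj) fun c => sum_ind_mul_rk_lt hG _ c
      exact ⟨⟨c, hc⟩, fun _ => ⟨hal, hle.le⟩⟩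
    · exact ⟨⟨0, hm⟩, fun h => absurd h hj⟩
  choose c hc using hex
  have hbest : ∀ v : Fin (w 0), leaderRank w G φ v = bestRank (E v) (leaders w G φ) :=
    hE.leaderRank_eq ⟨_, hmem⟩
  let U : Finset (Fin (w 0)) := univ.filter fun v => digit w G u v = 1
  have hU' : ∀ v : Fin (w 0), digit w G u v = 1 ↔ v ∈ U := by simp [U]
  have hU := sum_ind_mul (P := fun v => digit w G u v = 1) hU'
  refine ⟨fun v => c (digit w G ψ v), U, _, hmem, ?_, fun v e => ?_, fun v hv => ?_, ?_, ?_⟩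
  · refine (card_le_card (t := (range (w 2)).image c) ?_).trans (card_image_le.trans (by simp))
    exact image_subset_iff.2 fun v _ => mem_image_of_mem _ (mem_range.2 (hψ v v.2))
  · exact (hc _ (hψ v v.2)).1.1 (congrArg Fin.val e)
  · obtain ⟨h1, h2⟩ := (hc _ (hψ v v.2)).1.2.2 v v.2 ⟨rfl, (mem_filter.1 hv).2⟩
    rw [hbest, hE.rk_eq] at h2
    exact ⟨fun h => h1 (mem_leaders.1 h), h2⟩
  · have e1 : ∑ v ∈ U, rank (E v) (c (digit w G ψ v)) =
        ∑ j ∈ range (w 2), markedSum w G ψ u j (c j) := by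
      have := sum_fiber hψ fun j v => ind (digit w G u v = 1) * rk w v (c j)
      simp only [markedSum, ind_and, mul_assoc]
      rw [this, hU]
      exact Finset.sum_congr rfl fun v _ => (hE.rk_eq v _).symm
    have e2 : ∑ j ∈ range (w 2), markedSum w G ψ u j (c j) ≤
        ∑ j ∈ range (w 2), markedMin w G φ s ψ u x j :=
      Finset.sum_le_sum fun j hj => (hc j (mem_range.1 hj)).2
    rw [hU] at hmark
    rw [e1, ← Finset.sum_congr rfl fun v _ => hbest v]
    exact e2.trans hmark
  · have e1 : ∑ v, rank (E v) (c (digit w G ψ v)) =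
        ∑ j ∈ range (w 2), clusterSum w G ψ j (c j) := by
      rw [← hE.sum_rk (t := fun v => c (digit w G ψ v)) fun _ => rfl]
      exact (sum_fiber hψ fun j v => rk w v (c j)).symm
    have e2 : ∑ j ∈ range (w 2), clusterSum w G ψ j (c j) ≤
        ∑ j ∈ range (w 2), (clusterMin w G ψ j s + digit w G x j) :=
      Finset.sum_le_sum fun j hj => (hc j (mem_range.1 hj)).1.2.1
    have e3 : ∑ v ∈ range (w 0), ind (digit w G u v = 1) = U.card := sum_ind hU'
    rw [e3, Finset.sum_range (fun v => leaderRank w G φ v),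
      Finset.sum_congr rfl fun v _ => hbest v] at htot
    rw [e1]
    exact e2.trans htot

/-- The point is that the excesses of the given representatives over the cluster minima may be
assumed to be at most `n`, so that they are digits in base `n + 1`. -/
theorem Lists.overtaken (hE : Lists w E) (hG : Large w G) (hm : 1 < w 1) (hn : 0 < w 0)
    (hkn : w 2 ≤ w 0) {φ : ℕ} {t : Fin (w 0) → Fin (w 1)} {U : Finset (Fin (w 0))} {s : Fin (w 1)}
    (h : Overtaking E (w 2) (w 3) (leaders w G φ) t U s) : Overtaken w G φ := by
  classical
  obtain ⟨j₀, hj₀, hs⟩ := mem_leaders.1 h.mem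
  have hex : ∃ c < w 1, c ≠ (s : ℕ) := by
    by_cases h0 : (s : ℕ) = 0
    · exact ⟨1, hm, by omega⟩
    · exact ⟨0, by omega, Ne.symm h0⟩
  have hbest : ∀ v : Fin (w 0), leaderRank w G φ v = bestRank (E v) (leaders w G φ) :=
    hE.leaderRank_eq ⟨_, h.mem⟩
  have hbest' : ∑ v ∈ range (w 0), leaderRank w G φ v =
      ∑ v, bestRank (E v) (leaders w G φ) := by
    rw [Finset.sum_range]
    exact Finset.sum_congr rfl fun v _ => hbest v
  obtain ⟨ψ, hψG, hψ, c, hc, hct⟩ := exists_clustering hG hkn h.card_le hex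
    fun v e => h.ne v (Fin.ext e)
  have hsum : ∑ j ∈ range (w 2), clusterSum w G ψ j (c j) = ∑ v, rank (E v) (t v) := by
    rw [← hE.sum_rk (t := fun v => c (digit w G ψ v)) hct]
    exact sum_fiber hψ fun j v => rk w v (c j)
  have hmin : ∀ j, clusterMin w G ψ j s ≤ clusterSum w G ψ j (c j) := fun j =>
    (clusterMin_spec hG ψ j hex).2 _ (hc j).1 (hc j).2
  refine ⟨j₀, hj₀, ψ, hψG, hψ, ?_⟩
  rw [hs]
  -- If the cluster minima fit the budget without a bonus, they replace the given representatives,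
  -- with no marks and no excess. The code `z` of the zero function serves for both.
  by_cases hcase : ∑ j ∈ range (w 2), clusterMin w G ψ j s ≤
      w 3 + ∑ v, bestRank (E v) (leaders w G φ)
  · obtain ⟨z, hz, hz0⟩ := exists_digits hG.pow_le hG.n_le (fun _ => 0) fun _ _ => Nat.zero_le _
    refine ⟨z, hz, z, hz, fun j hj => ?_, ?_, ?_⟩
    · obtain ⟨⟨d, hd, hds, hdm⟩, -⟩ := clusterMin_spec hG ψ j hex
      refine ⟨d, hd, hds, by omega, fun v hv e => ?_⟩
      rw [hz0 v hv] at e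
      omega
    · have : ∀ j ∈ range (w 2), markedMin w G φ s ψ z z j = 0 := by
        intro j hj
        obtain ⟨⟨d, hd, hds, hdm⟩, -⟩ := clusterMin_spec hG ψ j hex
        refine leastBelow_eq ((Nat.zero_le _).trans_lt hG.mul_lt)
          ⟨d, hd, ⟨hds, by omega, fun v hv e => ?_⟩, ?_⟩ (by simp)
        · rw [hz0 v hv] at e
          omega
        · refine le_of_eq (Finset.sum_eq_zero fun v hv => ?_)
          rw [ind_of_not, zero_mul]
          rw [hz0 v (mem_range.1 hv)]
          omega
      rw [Finset.sum_eq_zero this]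
      exact Nat.zero_le _
    · have : ∑ j ∈ range (w 2), (clusterMin w G ψ j s + digit w G z j) =
          ∑ j ∈ range (w 2), clusterMin w G ψ j s :=
        Finset.sum_congr rfl fun j hj => by
          rw [hz0 j ((mem_range.1 hj).trans_le hkn), add_zero]
      rw [this, hbest']
      omega
  · have hUn : U.card ≤ w 0 := by simpa using card_le_univ U
    -- The minima exceed `B` plus the cost of `S`, while the actual sums exceed it by at most `|U|`;
    -- the difference is below `|U| ≤ n`.
    have hexc : ∑ j ∈ range (w 2), (clusterSum w G ψ j (c j) - clusterMin w G ψ j s) ≤ w 0 := by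
      have e1 : ∑ j ∈ range (w 2), (clusterSum w G ψ j (c j) - clusterMin w G ψ j s) +
          ∑ j ∈ range (w 2), clusterMin w G ψ j s =
          ∑ j ∈ range (w 2), clusterSum w G ψ j (c j) := by
        rw [← Finset.sum_add_distrib]
        exact Finset.sum_congr rfl fun j _ => Nat.sub_add_cancel (hmin j)
      have := h.total_le
      omega
    obtain ⟨u, hu, hud⟩ := exists_digits hG.pow_le hG.n_le
      (fun v => if hv : v < w 0 then if (⟨v, hv⟩ : Fin (w 0)) ∈ U then 1 else 0 else 0) fun v hv => by
        simp only [dif_pos hv]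
        split_ifs <;> omega
    obtain ⟨x, hx, hxd⟩ := exists_digits hG.pow_le hG.n_le
      (fun j => if j < w 2 then clusterSum w G ψ j (c j) - clusterMin w G ψ j s else 0) fun j _ => by
        by_cases hj : j < w 2
        · simp only [if_pos hj]
          exact (Finset.single_le_sum (f := fun j => clusterSum w G ψ j (c j) -
            clusterMin w G ψ j s) (fun _ _ => Nat.zero_le _) (mem_range.2 hj)).trans hexc
        · simp [hj]
    have hud' : ∀ v : Fin (w 0), digit w G u v = 1 ↔ v ∈ U := by
      intro v
      rw [hud v v.2]
      simp
    have hxd' : ∀ j < w 2, clusterMin w G ψ j s + digit w G x j = clusterSum w G ψ j (c j) := by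
      intro j hj
      have := hmin j
      rw [hxd j (hj.trans_le hkn), if_pos hj]
      omega
    have hU := sum_ind_mul (P := fun v => digit w G u v = 1) hud'
    have hal : ∀ j < w 2, Allowed w G φ s ψ u x j (c j) := by
      intro j hj
      refine ⟨(hc j).2, (hxd' j hj).ge, ?_⟩
      rintro v hv ⟨rfl, h2⟩
      have hv' := h.below ⟨v, hv⟩ ((hud' ⟨v, hv⟩).1 h2)
      have e := hct ⟨v, hv⟩
      simp only at e
      rw [e]
      refine ⟨fun h3 => hv'.1 (mem_leaders.2 h3), ?_⟩
      have := hv'.2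
      rwa [← hbest ⟨v, hv⟩, ← hE.rk_eq ⟨v, hv⟩] at this
    refine ⟨u, hu, x, hx, fun j hj => ⟨c j, (hc j).1, hal j hj⟩, ?_, ?_⟩
    · have e1 : ∑ j ∈ range (w 2), markedMin w G φ s ψ u x j ≤
          ∑ j ∈ range (w 2), markedSum w G ψ u j (c j) :=
        Finset.sum_le_sum fun j hj => (leastBelow_min (N := G) (f := markedSum w G ψ u j)
          ⟨c j, (hc j).1, hal j (mem_range.1 hj)⟩ fun c => sum_ind_mul_rk_lt hG _ c).2 _ (hc j).1
            (hal j (mem_range.1 hj))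
      have e2 : ∑ j ∈ range (w 2), markedSum w G ψ u j (c j) = ∑ v ∈ U, rank (E v) (t v) := by
        have := sum_fiber hψ fun j v => ind (digit w G u v = 1) * rk w v (c j)
        simp only [markedSum, ind_and, mul_assoc]
        rw [this, hU fun v => rk w v (c (digit w G ψ v))]
        exact Finset.sum_congr rfl fun v _ => by rw [hct, hE.rk_eq]
      have e3 : ∑ v ∈ U, leaderRank w G φ v = ∑ v ∈ U, bestRank (E v) (leaders w G φ) :=
        Finset.sum_congr rfl fun v _ => hbest v
      rw [hU, e3]
      exact e1.trans (e2 ▸ h.marked_le)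
    · have e3 : ∑ v ∈ range (w 0), ind (digit w G u v = 1) = U.card := sum_ind hud'
      rw [Finset.sum_congr rfl fun j hj => hxd' j (mem_range.1 hj), hsum, e3, hbest']
      exact h.total_le

/-! ### Degenerate instances and the equivalence. -/

theorem betaCC_eq_of_card_le {m n : ℕ} {k : ℕ} (hk : k = 0 ∨ m ≤ k) (E E' : Election m n) :
    betaCC m n E' k = betaCC m n E k := by
  have key : ∀ S T : Finset (Fin m), S.card = k → T.card = k → S = T := by
    intro S T hS hT
    rcases hk with rfl | hk
    · rw [Finset.card_eq_zero.1 hS, Finset.card_eq_zero.1 hT]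
    · have hcard : ∀ R : Finset (Fin m), R.card = k → R = univ := fun R hR =>
        Finset.eq_univ_of_card R (le_antisymm (card_le_univ R) (by simpa [hR] using hk))
      rw [hcard S hS, hcard T hT]
  have all : ∀ (F : Election m n) (S : Finset (Fin m)), S ∈ betaCC m n F k ↔ S.card = k :=
    fun F S => ⟨fun h => h.1, fun h => ⟨h, fun T hT => by rw [key T S hT h]⟩⟩
  ext S
  rw [all, all]

/-- The formula of the algorithm describes the change of the outcome. -/
theorem Lists.answer_iff (hE : Lists w E) (hG : 0 < w 0 → Large w G) : Answer w G ↔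
    ∃ E', SwapReach (w 3) E E' ∧ betaCC (w 1) (w 0) E' (w 2) ≠ betaCC (w 1) (w 0) E (w 2) := by
  by_cases h0 : (0 < w 0 ∧ 0 < w 2) ∧ w 2 < w 1 ∧ 0 < w 3
  · obtain ⟨⟨hn, hk⟩, hkm, hB⟩ := h0
    have hm : 0 < w 1 := by omega
    have hG := hG hn
    have hA : Answer w G ↔ (numTops w < w 2 ∧ TopsChange w) ∨
        (w 2 ≤ numTops w ∧ ∃ φ < G, Optimal w G φ ∧ Overtaken w G φ) := by
      simp [Answer, hn, hk, hkm, hB]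
    rw [hA, hE.numTops_eq hm]
    by_cases ht : (tops E).card < w 2
    · rw [change_iff_of_few_tops hk hkm ht, hE.topsChange_iff hm]
      simp [ht]
    · rw [not_lt] at ht
      simp only [not_lt.2 ht, false_and, false_or, ht, true_and]
      constructor
      · rintro ⟨φ, -, hφ, ho⟩
        rw [change_iff_of_many_tops hk hkm hB ht (hE.leaders_mem_betaCC hG hk hkm ht hφ)]
        exact hE.exists_overtaking hG hm ho
      · intro hch
        obtain ⟨φ, hφG, hφ⟩ := hE.exists_optimal hG hk hkm ht
        rw [change_iff_of_many_tops hk hkm hB ht (hE.leaders_mem_betaCC hG hk hkm ht hφ)] at hch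
        obtain ⟨t, U, s, h⟩ := hch
        exact ⟨φ, hφG, hφ, hE.overtaken hG (by omega) hn (ht.trans (card_tops_le hm E)) h⟩
  · refine iff_of_false (fun h => h0 ⟨h.1, h.2.1⟩) ?_
    rintro ⟨E', hr, hne⟩
    by_cases hk : w 2 = 0 ∨ w 1 ≤ w 2
    · exact hne (betaCC_eq_of_card_le hk E E')
    · push Not at hk
      obtain ⟨b, hb, hv⟩ := hr.exists_votes
      refine hne (congrArg (fun F => betaCC (w 1) (w 0) F (w 2)) (funext fun v => ?_))
      -- The voter `v` rules out `w 0 = 0`, so the number of swaps is the condition that fails.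
      have hB : w 3 = 0 := by
        have := v.2
        by_contra h
        exact h0 ⟨⟨by omega, by omega⟩, hk.2, by omega⟩
      have hbv : b v ≤ 0 :=
        (Finset.single_le_sum (fun _ _ => Nat.zero_le _) (mem_univ v)).trans (hb.trans hB.le)
      have := hv v
      rw [Nat.le_zero.1 hbv] at this
      generalize E' v = x at this
      cases this
      rfl

end Bridge
end RobustCC

namespace RobustCC

/-! ### Assembling the program -/

/-- The power `(w 0 + 1) ^ w 0`. -/
def Tm.powT : Tm := .iter 10 nT (.const 1) (.sum 11 (.add nT (.const 1)) (.var 10))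

theorem Tm.eval_powT {w : ℕ → ℕ} {G : ℕ} {e : ℕ → ℕ} (hn : w 0 + 1 ≤ G) :
    powT.eval w G e = (w 0 + 1) ^ w 0 := by
  have h : w 0 ≤ G := by omega
  have key : ∀ i, (fun y => (w 0 + 1) * y)^[i] 1 = (w 0 + 1) ^ i := by
    intro i
    induction i with
    | zero => rfl
    | succ i ih => rw [Function.iterate_succ_apply', ih, pow_succ']
  simp [powT, eval, nT, hn, h, key]

/-- The program: it computes the global bound in stages, and then the answer. -/
def decisionProg : Prog :=
  .seq (.assign 1 (.add (.add (.var 0) (.read 0 (.const 0))) (.const 2))) <|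
  .seq (Tm.powT.prog 1) <|
  .seq (.assign 1 (.add (.var 1) (.var 3))) <|
  .seq ((Tm.sum 10 .bound .bound).prog 1) <|
  .seq (.assign 1 (.var 3)) <|
  .seq (Tm.answerT.prog 1) (.assign 0 (.var 3))

/-- The global bound for inputs of length `l` with `n` voters. -/
def globalBound (l n : ℕ) : ℕ := (l + n + 2 + (n + 1) ^ n) * (l + n + 2 + (n + 1) ^ n)

/-- The cut-off must be large enough before a term is run. Therefore `l + n + 2` serves for
computing the power, the power is added, and the result is squared by repeated addition. Each stage
leaves its result in machine variable `3`, which is slot `1`, and the input array stays intact. -/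
theorem exists_decisionProg_time : ∃ K D, ∀ s : State,
    (0 < s.arr 0 0 → s.arr 0 1 ≤ globalBound (s.var 0) (s.arr 0 0)) →
    Ends decisionProg s (K * (globalBound (s.var 0) (s.arr 0 0) + 1) ^ D) fun s' =>
      s'.var 0 = ind (Answer (s.arr 0) (globalBound (s.var 0) (s.arr 0 0))) := by
  obtain ⟨K₁, D₁, h₁⟩ := Tm.powT.exists_spec
  obtain ⟨K₂, D₂, h₂⟩ := (Tm.sum 10 .bound .bound).exists_spec
  obtain ⟨K₃, D₃, h₃⟩ := Tm.answerT.exists_spec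
  refine ⟨18 + (K₁ + (K₂ + K₃)), 0 + (D₁ + (D₂ + D₃)), fun s hs => ?_⟩
  set l := s.var 0 with hl
  set n := s.arr 0 0 with hn
  set G₁ := l + n + 2 with hG₁
  set G₂ := l + n + 2 + (n + 1) ^ n with hG₂
  set G := globalBound l n with hG
  have hGG : G = G₂ * G₂ := rfl
  have h12 : G₁ ≤ G₂ := Nat.le_add_right _ _
  have h2G : G₂ ≤ G := by rw [hGG]; exact Nat.le_mul_of_pos_left _ (by omega)
  refine (Ends.assign_seq (T := K₁ * (G₁ + 1) ^ D₁ + (4 + (K₂ * (G₂ + 1) ^ D₂ +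
    (2 + (K₃ * (G + 1) ^ D₃ + 2))))) ?_).mono ?_ (fun _ h => h)
  swap
  · have e1 : K₁ * (G₁ + 1) ^ D₁ ≤ K₁ * (G + 1) ^ D₁ := by gcongr; omega
    have e2 : K₂ * (G₂ + 1) ^ D₂ ≤ K₂ * (G + 1) ^ D₂ := by gcongr
    have e3 := bound_add (g := G) (K₁ := K₂) (D₁ := D₂) (K₂ := K₃) (D₂ := D₃)
    have e4 := bound_add (g := G) (K₁ := K₁) (D₁ := D₁) (K₂ := K₂ + K₃) (D₂ := D₂ + D₃)
    have e5 := bound_add (g := G) (K₁ := 18) (D₁ := 0) (K₂ := K₁ + (K₂ + K₃))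
      (D₂ := D₁ + (D₂ + D₃))
    have e6 : (G + 1) ^ 0 = 1 := pow_zero _
    simp only [Expr.cost]
    omega
  have hv : (Expr.add (.add (.var 0) (.read 0 (.const 0))) (.const 2)).eval s = G₁ := rfl
  rw [hv]
  have a1 : (s.setVar 1 G₁).var 1 = G₁ := State.var_setVar_self _ _ _
  refine Ends.seq (by simpa only [a1] using h₁ 1 (s.setVar 1 G₁) one_pos) ?_
  rintro s₁ ⟨g₁, v₁⟩
  rw [State.arr_setVar, Tm.eval_powT (by omega)] at v₁
  have b1 : s₁.var 1 = G₁ := g₁.var_one one_pos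
  have hv₂ : (Expr.add (.var 1) (.var 3)).eval s₁ = G₂ := by
    simp only [Expr.eval, b1]
    exact congrArg _ v₁
  refine Ends.assign_seq ?_
  rw [hv₂]
  have a2 : (s₁.setVar 1 G₂).var 1 = G₂ := State.var_setVar_self _ _ _
  refine Ends.seq (by simpa only [a2] using h₂ 1 (s₁.setVar 1 G₂) one_pos) ?_
  rintro s₂ ⟨g₂, v₂⟩
  have hv₃ : (Expr.var 3).eval s₂ = G := by
    refine v₂.trans ?_
    simp [Tm.eval, hGG]
  refine Ends.assign_seq ?_
  rw [hv₃]
  have a3 : (s₂.setVar 1 G).var 1 = G := State.var_setVar_self _ _ _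
  refine Ends.seq (by simpa only [a3] using h₃ 1 (s₂.setVar 1 G) one_pos) ?_
  rintro s₃ ⟨g₃, v₃⟩
  have harr : (s₂.setVar 1 G).arr = s.arr := by
    rw [State.arr_setVar, g₂.arr, State.arr_setVar, g₁.arr, State.arr_setVar]
  refine Ends.assign ?_
  rw [State.var_setVar_self]
  refine v₃.trans ?_
  have hnG : n + 1 ≤ G := by omega
  rw [harr, Tm.eval_answerT hnG hs]

theorem primrec_pow : Primrec₂ ((· ^ ·) : ℕ → ℕ → ℕ) := by
  refine (Primrec.nat_rec' (f := fun p : ℕ × ℕ => p.2) (g := fun _ => 1)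
    (h := fun p q => p.1 * q.2) Primrec.snd (Primrec.const 1) ?_).of_eq ?_
  · exact Primrec.nat_mul.comp (Primrec.fst.comp Primrec.fst) (Primrec.snd.comp Primrec.snd)
  · rintro ⟨a, b⟩
    induction b with
    | zero => simp
    | succ b ih =>
      simp only at ih ⊢
      rw [ih, pow_succ']

theorem length_le_inputLength (w : List ℕ) : w.length ≤ inputLength w := by
  induction w with
  | nil => simp [inputLength]
  | cons a w ih =>
    simp only [inputLength, List.map_cons, List.sum_cons, List.length_cons] at ih ⊢
    omega

/-- Separates the part depending on `n` from a power of the input length, as FPT demands. -/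
theorem globalBound_le {l L n : ℕ} (h : l ≤ L) (hL : 1 ≤ L) :
    globalBound l n + 1 ≤ ((n + 3 + (n + 1) ^ n) ^ 2 + 1) * L ^ 2 := by
  have h1 : l + n + 2 + (n + 1) ^ n ≤ (n + 3 + (n + 1) ^ n) * L := by
    have : (n + 2 + (n + 1) ^ n) * 1 ≤ (n + 2 + (n + 1) ^ n) * L := by gcongr
    nlinarith
  calc globalBound l n + 1 ≤ ((n + 3 + (n + 1) ^ n) * L) * ((n + 3 + (n + 1) ^ n) * L) + 1 * L ^ 2 := by
        unfold globalBound
        gcongr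
        rw [one_mul]
        exact Nat.one_le_pow _ _ hL
    _ = _ := by ring

/-- A decision problem is in FPT if the formula of the algorithm describes its yes-instances. -/
theorem inFPT_of_answer_iff (P : ParamProblem Instance) (henc : P.encode = Instance.encode)
    (hpar : P.param = Instance.n)
    (h : ∀ I : Instance, Answer (fun i => I.encode.getD i 0)
      (globalBound I.encode.length I.n) ↔ P.yes I)
    (hm : ∀ I : Instance, 0 < I.n → I.m ≤ I.encode.length) : P.InFPT := by
  obtain ⟨K, D, hK⟩ := exists_decisionProg_time
  refine ⟨decisionProg, fun n => K * ((n + 3 + (n + 1) ^ n) ^ 2 + 1) ^ D, 2 * D, ?_, fun I => ?_⟩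
  · refine Primrec.to_comp ?_
    have h1 : Primrec fun n : ℕ => n + 3 + (n + 1) ^ n :=
      Primrec.nat_add.comp (Primrec.nat_add.comp Primrec.id (Primrec.const 3))
        (primrec_pow.comp (Primrec.nat_add.comp Primrec.id (Primrec.const 1)) Primrec.id)
    exact Primrec.nat_mul.comp (Primrec.const K) (primrec_pow.comp
      (Primrec.nat_add.comp (primrec_pow.comp h1 (Primrec.const 2)) (Primrec.const 1))
      (Primrec.const D))
  · have e0 : (State.init I.encode).var 0 = I.encode.length := rfl
    have e1 : (State.init I.encode).arr 0 = fun i => I.encode.getD i 0 := rfl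
    have e2 : (State.init I.encode).arr 0 0 = I.n := rfl
    have e3 : (State.init I.encode).arr 0 1 = I.m := rfl
    obtain ⟨s', t, hr, ht, hq⟩ := hK (State.init I.encode) (by
      rw [e2, e3, e0]
      intro h0
      refine (hm I h0).trans ?_
      unfold globalBound
      nlinarith [Nat.zero_le ((I.n + 1) ^ I.n)])
    rw [e2, e0] at ht hq
    rw [e1, h I] at hq
    rw [henc, hpar]
    refine ⟨s', t, hr, ht.trans ?_, fun hy => by rw [hq, ind_of hy],
      fun hy => by rw [hq, ind_of_not hy]⟩
    have hlen := length_le_inputLength I.encode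
    have h4 : 1 ≤ inputLength I.encode := by
      refine le_trans ?_ hlen
      simp [Instance.encode]
    calc _ ≤ K * (((I.n + 3 + (I.n + 1) ^ I.n) ^ 2 + 1) * inputLength I.encode ^ 2) ^ D := by
          gcongr
          exact globalBound_le hlen h4
      _ = _ := by rw [mul_pow, ← pow_mul]; ring

end RobustCC

namespace RobustCC

/-! ### Encodings of instances -/

theorem getD_flatten_of_length_eq {m : ℕ} {l : List (List ℕ)} (hl : ∀ x ∈ l, x.length = m)
    {v i : ℕ} (hv : v < l.length) (hi : i < m) :
    l.flatten.getD (m * v + i) 0 = (l[v]).getD i 0 := by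
  induction l generalizing v with
  | nil => simp at hv
  | cons x l ih =>
    have hx : x.length = m := hl x (by simp)
    cases v with
    | zero => simp [List.getElem?_append_left (hx.symm ▸ hi)]
    | succ v =>
      have h := ih (fun y hy => hl y (by simp [hy])) (v := v) (by simpa using hv)
      rw [List.flatten_cons, List.getD_append_right _ _ _ _ (by rw [hx, mul_add]; omega),
        show m * (v + 1) + i - x.length = m * v + i by rw [hx, mul_add]; omega, h]
      rfl

theorem Instance.length_encode (I : Instance) : I.encode.length = 4 + I.n * I.m := by
  simp [Instance.encode, List.length_flatMap]
  omega

theorem Instance.lists (I : Instance) :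
    Lists (fun i => I.encode.getD i 0) (E := I.election) := by
  intro v i
  have hw : ∀ j, I.encode.getD (4 + j) 0 = ((List.finRange I.n).map fun v =>
      List.ofFn fun i : Fin I.m => ((I.election v i : Fin I.m) : ℕ)).flatten.getD j 0 := by
    intro j
    rw [Instance.encode, List.getD_append_right _ _ _ _ (by simp), ← List.flatMap_def]
    simp
  have hv : (v : ℕ) < I.n := v.2
  have hi : (i : ℕ) < I.m := i.2
  change I.encode.getD (4 + I.m * v + i) 0 = _
  rw [add_assoc, hw, getD_flatten_of_length_eq (m := I.m) (by simp)
    (v := v) (i := i) (by simpa using hv) hi]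
  simp [hi]
  rfl

/-- The votes occupy `n * m` entries of the encoding, so its length already exceeds every sum of
ranks. -/
theorem large_globalBound (w : ℕ → ℕ) {l : ℕ} (hl : l = 4 + w 0 * w 1) :
    Large w (globalBound l (w 0)) := by
  have h : l + w 0 + 2 + (w 0 + 1) ^ w 0 ≤ globalBound l (w 0) :=
    Nat.le_mul_of_pos_left _ (by omega)
  exact ⟨by omega, by omega, by omega⟩

end RobustCC

theorem mainTheorem11 :
    (RobustCC.robustnessRadiusByVoters RobustCC.betaCC).InFPT := by
  refine RobustCC.inFPT_of_answer_iff _ rfl rfl (fun I => ?_) fun I hn => ?_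
  · exact I.lists.answer_iff fun _ => RobustCC.large_globalBound _ I.length_encode
  · rw [I.length_encode]
    exact (Nat.le_mul_of_pos_left _ hn).trans (Nat.le_add_left _ _)
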